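/- Conventions. All Hilbert spaces are finite-dimensional and logarithms are to base 2. A subnormalized state on $\mathcal H$ is a positive semidefinite operator $\rho$ with $\operatorname{tr}\rho\le 1$; the set of these is $\mathcal P_{\le}(\mathcal H)$. For subnormalized states the purified distance is $P(\rho,\sigma)=\sqrt{1-F_*(\rho,\sigma)^2}$ with $F_*(\rho,\sigma)=\|\sqrt\rho\sqrt\sigma\|_1+\sqrt{(1-\operatorname{tr}\rho)(1-\operatorname{tr}\sigma)}$. For a subnormalized state $\rho_{XY}$ on $\mathcal H_X\otimes\mathcal H_Y$, $$H_{\min}(X|Y)_\rho=\sup_{\sigma\in\mathcal P_{\le}(\mathcal H_Y)}\bigl(-\inf\{\lambda\in\mathbb R:\rho_{XY}\le 2^\lambda\, I_X\otimes\sigma\}\bigr)\in[-\infty,\infty],$$ $$H^\varepsilon_{\min}(X|Y)_\rho=\sup\{H_{\min}(X|Y)_{\tau}:\tau\in\mathcal P_{\le}(\mathcal H_X\otimes\mathcal H_Y),\ P(\tau,\rho_{XY})\le\varepsilon\};$$ for a state of a larger system these refer to its reduced state $\rho_{XY}$. Let $G=(V,E)$ be a finite graph, $V=V_\partial\sqcup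 V_b$ a partition into boundary and bulk vertices, $A\subseteq V_\partial$ and $\bar A=V_\partial\setminus A$. Each edge $e$ has a bond dimension $D_e$, each half-edge $(e,x)$ (with $x$ an endpoint of $e$) carries $\mathcal H_{e,x}=\mathbb C^{D_e}$, a set of half-edges carries the tensor product of their spaces, $\mathcal H_e=\bigotimes_{x\in e}\mathcal H_{e,x}$, a set $B\subseteq V$ stands for the set of all half-edges $(e,x)$ with $x\in B$, and $\mathcal H_V$ is the tensor product over all half-edges. Let $\gamma_{A,1}$ and $\gamma_{A,2}$ be the sets of edges incident to $A$ and to $\bar A$ respectively, assume $\gamma_{A,1}\cap\gamma_{A,2}=\emptyset$, and let $E_b=E\setminus(\gamma_{A,1}\cup\gamma_{A,2})$. Let $C(A)=\{\Delta_A\subseteq V:\Delta_A\cap V_\partial=A\}$ be the set of cuts for $A$, and for $\Delta_A\in C(A)$ let $$Y^{\Delta_A}=\{(e,x): e=(xy),\ x\in V\setminus\Delta_A,\ y\in A\}.$$ Statement. Let $\varepsilon\ge 0$ and let $\phi=|\phi\rangle\langle\phi|\in\mathcal P_{\le}(\mathcal H_V)$ be a pure subnormalized state with $$|\phi\rangle=|\phi_{\gamma_{A,1}}\rangle\otimes|\phi_{\gamma_{A,2}}\rangle\otimes\bigotimes_{e\in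 E_b}|\phi_e\rangle,$$ where $|\phi_e\rangle\in\mathcal H_e$ is arbitrary for $e\in E_b$, and where for $i=1,2$ the vector $|\phi_{\gamma_{A,i}}\rangle$ has a Schmidt decomposition in the standard basis along the half-edges, that is, $$|\phi_{\gamma_{A,i}}\rangle=\sum_{I=(I_e)_{e\in\gamma_{A,i}}}\sqrt{\lambda^{(i)}_I}\ \bigotimes_{e\in\gamma_{A,i}}|I_eI_e\rangle\qquad\text{with all }\lambda^{(i)}_I\ge 0.$$ Then there exists a state $\phi^\varepsilon\in\mathcal P_{\le}(\mathcal H_V)$ such that $$P(\phi,\phi^\varepsilon)\le 2\sqrt{2^{|V_b|}\,\varepsilon}$$ and, for all cuts $\Delta_A\in C(A)$ simultaneously, $$H_{\min}(\Delta_A\setminus A\,|\,A)_{\phi^\varepsilon}\ \ge\ H^{\varepsilon}_{\min}(\Delta_A\setminus A\,|\,A\,Y^{\Delta_A})_{\phi}.$$ -/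

import Mathlib

open scoped Kronecker ComplexOrder

noncomputable section

/-! ## Finite-dimensional quantum states, purified distance, conditional min-entropy -/

/-- `ρ` is a subnormalized state: positive semidefinite with trace at most one. -/
def IsSubState {m : Type*} [Fintype m] (ρ : Matrix m m ℂ) : Prop :=
  ρ.PosSemidef ∧ ρ.trace.re ≤ 1

/-- The pure state `|v⟩⟨v|`. -/
def pureState {m : Type*} (v : m → ℂ) : Matrix m m ℂ :=
  Matrix.vecMulVec v (star v)

open scoped MatrixOrder in
/-- The positive semidefinite square root of a positive semidefinite matrix. -/
def psdSqrt {m : Type*} [Fintype m] [DecidableEq m] (M : Matrix m m ℂ) : Matrix m m ℂ :=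
  CFC.sqrt M

/-- The Schatten 1-norm `tr √(Mᴴ M)`. -/
def traceNorm {m : Type*} [Fintype m] [DecidableEq m] (M : Matrix m m ℂ) : ℝ :=
  (psdSqrt (M.conjTranspose * M)).trace.re

/-- The fidelity `‖√ρ √σ‖₁`. -/
def fidelity {m : Type*} [Fintype m] [DecidableEq m] (ρ σ : Matrix m m ℂ) : ℝ :=
  traceNorm (psdSqrt ρ * psdSqrt σ)

/-- The generalized fidelity of subnormalized states. -/
def generalizedFidelity {m : Type*} [Fintype m] [DecidableEq m] (ρ σ : Matrix m m ℂ) : ℝ :=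
  fidelity ρ σ + √((1 - ρ.trace.re) * (1 - σ.trace.re))

/-- The purified distance of subnormalized states. -/
def purifiedDistance {m : Type*} [Fintype m] [DecidableEq m] (ρ σ : Matrix m m ℂ) : ℝ :=
  √(1 - generalizedFidelity ρ σ ^ 2)

/-- `H_min(A|B)_{ρ|σ} = - inf {t : ρ ≤ 2^t (I ⊗ σ)}` (Loewner order), with values in `[-∞, ∞]`;
the first factor `m` labels a basis of `A`, the second factor `n` a basis of `B`. -/
def condMinEntropyRel {m n : Type*} [Fintype m] [DecidableEq m] [Fintype n]
    (ρ : Matrix (m × n) (m × n) ℂ) (σ : Matrix n n ℂ) : EReal :=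
  - sInf {x : EReal | ∃ t : ℝ, x = (t : EReal) ∧
      ((((2 : ℝ) ^ t : ℝ) : ℂ) • ((1 : Matrix m m ℂ) ⊗ₖ σ) - ρ).PosSemidef}

/-- The conditional min-entropy `H_min(A|B)_ρ`. -/
def condMinEntropy {m n : Type*} [Fintype m] [DecidableEq m] [Fintype n]
    (ρ : Matrix (m × n) (m × n) ℂ) : EReal :=
  sSup {x : EReal | ∃ σ : Matrix n n ℂ, IsSubState σ ∧ x = condMinEntropyRel ρ σ}

/-- The smooth conditional min-entropy `H_min^ε(A|B)_ρ`. -/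
def smoothCondMinEntropy {m n : Type*} [Fintype m] [DecidableEq m] [Fintype n] [DecidableEq n]
    (ε : ℝ) (ρ : Matrix (m × n) (m × n) ℂ) : EReal :=
  sSup {x : EReal | ∃ τ : Matrix (m × n) (m × n) ℂ,
    IsSubState τ ∧ purifiedDistance τ ρ ≤ ε ∧ x = condMinEntropy τ}

/-! ## Tensor networks: half-edges and their Hilbert spaces -/

/-- A half-edge `(e, x)`: an edge `e` with one of its endpoints `x`. -/
@[ext]
structure HalfEdge {V : Type*} (G : SimpleGraph V) where
  edge : G.edgeSet
  vertex : V
  mem : vertex ∈ (edge : Sym2 V)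

instance HalfEdge.instFinite {V : Type*} [Finite V] (G : SimpleGraph V) :
    Finite (HalfEdge G) :=
  Finite.of_injective (fun h : HalfEdge G => (h.edge, h.vertex)) (by
    intro a b hab
    simp only [Prod.mk.injEq] at hab
    exact HalfEdge.ext hab.1 hab.2)

/-- The standard basis of `H_S = ⨂_{(e,x) ∈ S} ℂ^{D e}`, for a set `S` of half-edges. -/
def Config {V : Type*} {G : SimpleGraph V} (D : G.edgeSet → ℕ) (S : Set (HalfEdge G)) : Type _ :=
  (h : S) → Fin (D h.1.edge)

/-- The standard basis of the Hilbert space `H_V` of all half-edges. -/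
def FullConfig {V : Type*} {G : SimpleGraph V} (D : G.edgeSet → ℕ) : Type _ :=
  (h : HalfEdge G) → Fin (D h.edge)

instance Config.instFinite {V : Type*} [Finite V] {G : SimpleGraph V} (D : G.edgeSet → ℕ)
    (S : Set (HalfEdge G)) : Finite (Config D S) :=
  inferInstanceAs (Finite ((h : S) → Fin (D h.1.edge)))

instance FullConfig.instFinite {V : Type*} [Finite V] {G : SimpleGraph V} (D : G.edgeSet → ℕ) :
    Finite (FullConfig D) :=
  inferInstanceAs (Finite ((h : HalfEdge G) → Fin (D h.edge)))

instance Config.instFintype {V : Type*} [Finite V] {G : SimpleGraph V} (D : G.edgeSet → ℕ)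
    (S : Set (HalfEdge G)) : Fintype (Config D S) :=
  Fintype.ofFinite _

instance FullConfig.instFintype {V : Type*} [Finite V] {G : SimpleGraph V} (D : G.edgeSet → ℕ) :
    Fintype (FullConfig D) :=
  Fintype.ofFinite _

instance Config.instDecidableEq {V : Type*} {G : SimpleGraph V} (D : G.edgeSet → ℕ)
    (S : Set (HalfEdge G)) : DecidableEq (Config D S) :=
  Classical.decEq _

instance FullConfig.instDecidableEq {V : Type*} {G : SimpleGraph V} (D : G.edgeSet → ℕ) :
    DecidableEq (FullConfig D) :=
  Classical.decEq _

/-- Restriction of a basis label to the half-edges in `S`. -/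
def FullConfig.restrict {V : Type*} {G : SimpleGraph V} {D : G.edgeSet → ℕ} (c : FullConfig D)
    (S : Set (HalfEdge G)) : Config D S :=
  fun h => c h.1

open scoped Classical in
/-- The basis label of `H_V` with the given parts on the disjoint sets `S`, `T` and on the
remaining half-edges. -/
def glue {V : Type*} {G : SimpleGraph V} {D : G.edgeSet → ℕ} {S T : Set (HalfEdge G)}
    (a : Config D S) (b : Config D T) (c : Config D (S ∪ T)ᶜ) : FullConfig D :=
  fun h =>
    if hS : h ∈ S then a ⟨h, hS⟩
    else if hT : h ∈ T then b ⟨h, hT⟩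
    else c ⟨h, fun hST => hST.elim hS hT⟩

/-- The reduced state `ρ_{ST} = tr_{(S ∪ T)ᶜ} ρ` of a state `ρ` of `H_V` on two disjoint sets of
half-edges, as an operator on `H_S ⊗ H_T`. -/
def reducedState {V : Type*} [Finite V] {G : SimpleGraph V} {D : G.edgeSet → ℕ}
    (S T : Set (HalfEdge G)) (ρ : Matrix (FullConfig D) (FullConfig D) ℂ) :
    Matrix (Config D S × Config D T) (Config D S × Config D T) ℂ :=
  fun p q => ∑ c : Config D (S ∪ T)ᶜ, ρ (glue p.1 p.2 c) (glue q.1 q.2 c)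

/-! ## Cuts, and the sets of edges and half-edges in the transition lemma -/

/-- `C(A)`: the vertex sets that meet the boundary exactly in `A`. -/
def cuts {V : Type*} (bdry A : Set V) : Set (Set V) :=
  {Δ | Δ ∩ bdry = A}

/-- The half-edges at the vertices in `B`; they carry `H_B = ⨂_{x ∈ B} H_x`. -/
def halfEdgesAt {V : Type*} (G : SimpleGraph V) (B : Set V) : Set (HalfEdge G) :=
  {h | h.vertex ∈ B}

/-- The half-edges of the edges in `γ`; they carry `H_γ = ⨂_{e ∈ γ} H_e`. -/
def halfEdgesOf {V : Type*} {G : SimpleGraph V} (γ : Set G.edgeSet) : Set (HalfEdge G) :=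
  {h | h.edge ∈ γ}

/-- The edges incident to `B`. -/
def incidentEdges {V : Type*} (G : SimpleGraph V) (B : Set V) : Set G.edgeSet :=
  {e | ∃ x ∈ B, x ∈ (e : Sym2 V)}

/-- `Y^Δ`: the half-edges `(e, x)` with `e = (xy)`, `x ∉ Δ` and `y ∈ A`. -/
def outerHalfEdges {V : Type*} (G : SimpleGraph V) (A Δ : Set V) : Set (HalfEdge G) :=
  {h | h.vertex ∉ Δ ∧ ∃ y ∈ A, (h.edge : Sym2 V) = s(h.vertex, y)}

/-- The label of the basis vector `⨂_{e ∈ γ} |I_e I_e⟩` of `H_γ`. -/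
def diagConfig {V : Type*} {G : SimpleGraph V} {D : G.edgeSet → ℕ} (γ : Set G.edgeSet)
    (I : (e : γ) → Fin (D e.1)) : Config D (halfEdgesOf γ) :=
  fun h => I ⟨h.1.edge, h.2⟩

open scoped Classical in
/-- The vector `v ∈ H_γ` has a Schmidt decomposition in the standard basis along the half-edges:
`v = ∑_I √(lam I) ⨂_{e ∈ γ} |I_e I_e⟩`, where `I = (I_e)_{e ∈ γ}` and `lam I ≥ 0`. -/
def HasStandardSchmidt {V : Type*} [Fintype V] {G : SimpleGraph V} {D : G.edgeSet → ℕ}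
    (γ : Set G.edgeSet) (v : Config D (halfEdgesOf γ) → ℂ) : Prop :=
  ∃ lam : ((e : γ) → Fin (D e.1)) → ℝ, (∀ I, 0 ≤ lam I) ∧
    v = ∑ I : (e : γ) → Fin (D e.1),
      ((√(lam I) : ℝ) : ℂ) • (Pi.single (diagConfig γ I) 1 : Config D (halfEdgesOf γ) → ℂ)

open scoped Classical in
/-- The vector `v₁ ⊗ v₂ ⊗ ⨂_{e ∉ γ₁ ∪ γ₂} w_e` of `H_V`, for disjoint sets of edges `γ₁`, `γ₂`
(the factors `w_e` with `e ∈ γ₁ ∪ γ₂` are not used). -/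
def backgroundVector {V : Type*} [Fintype V] {G : SimpleGraph V} {D : G.edgeSet → ℕ}
    (γ₁ γ₂ : Set G.edgeSet) (v₁ : Config D (halfEdgesOf γ₁) → ℂ)
    (v₂ : Config D (halfEdgesOf γ₂) → ℂ)
    (w : (e : G.edgeSet) → Config D (halfEdgesOf {e}) → ℂ) : FullConfig D → ℂ :=
  fun c => v₁ (c.restrict _) * v₂ (c.restrict _) *
    ∏ e : ((γ₁ ∪ γ₂)ᶜ : Set G.edgeSet), w e.1 (c.restrict _)

end

/-!
After Schmidt decompositions of all its factors, `|φ⟩ = ∑_J √μ_J |B_J⟩`, where `J` labels all edges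
and `|B_J⟩` has the basis vector with label `J_e` at both ends of every edge `e`.

For a single cut, the reduced states are mixtures of superpositions of orthogonal vectors, so that a
smoothing state `τ ≤ 2^λ (I ⊗ σ)` on `(Δ \ A) ⊗ A Y` can be replaced by a filter: a classical
function `0 ≤ f_J ≤ 1` for which the weights `μ_J f_J` satisfy an operator inequality with the same
`λ` on `(Δ \ A) ⊗ A`. The loss `∑_J μ_J (1 - f_J)` is at most `ε`, by the classical form of the
Fuchs–van de Graaf argument, and the operator inequality survives any further filtering. By
compactness one filter serves all `λ`.

The product of the filters of all the cuts therefore serves every cut at once. There are at most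
`2 ^ |V_b|` cuts and the losses add up, which bounds the purified distance of the filtered state
from `φ`.
-/

open Matrix

section QuadraticForm

variable {m n ι : Type*} [Fintype m] [Fintype n]

/-- The value `⟨v|τ|v⟩` of the Hermitian form of `τ` (the real part of it, for general `τ`). -/
noncomputable def expVal (τ : Matrix m m ℂ) (v : m → ℂ) : ℝ :=
  (star v ⬝ᵥ (τ *ᵥ v)).re

theorem star_dotProduct_self_eq (v : m → ℂ) :
    star v ⬝ᵥ v = ((∑ p, ‖v p‖ ^ 2 : ℝ) : ℂ) := by
  simp only [dotProduct, Pi.star_apply, RCLike.star_def, Complex.conj_mul', Complex.ofReal_sum,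
    Complex.ofReal_pow]

theorem norm_star_dotProduct_sq_le (u v : m → ℂ) :
    ‖star u ⬝ᵥ v‖ ^ 2 ≤ (∑ p, ‖u p‖ ^ 2) * ∑ p, ‖v p‖ ^ 2 := by
  have h : ‖star u ⬝ᵥ v‖ ≤ ∑ p, ‖u p‖ * ‖v p‖ :=
    (norm_sum_le _ _).trans_eq (Finset.sum_congr rfl fun p _ => by simp)
  calc ‖star u ⬝ᵥ v‖ ^ 2 ≤ (∑ p, ‖u p‖ * ‖v p‖) ^ 2 := by gcongr
    _ ≤ _ := Finset.sum_mul_sq_le_sq_mul_sq _ _ _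

theorem exists_eq_conjTranspose_mul_self {τ : Matrix m m ℂ} (hτ : τ.PosSemidef) :
    ∃ B : Matrix m m ℂ, τ = Bᴴ * B := by
  classical
  open scoped MatrixOrder in
  have hnonneg : (0 : Matrix m m ℂ) ≤ τ := nonneg_iff_posSemidef.2 hτ
  have hsqrt : (CFC.sqrt τ).PosSemidef := nonneg_iff_posSemidef.1 (CFC.sqrt_nonneg τ)
  exact ⟨CFC.sqrt τ, by rw [hsqrt.isHermitian.eq, CFC.sqrt_mul_sqrt_self τ hnonneg]⟩

theorem dotProduct_conjTranspose_mul_self_mulVec (B : Matrix n m ℂ) (u v : m → ℂ) :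
    star u ⬝ᵥ ((Bᴴ * B) *ᵥ v) = star (B *ᵥ u) ⬝ᵥ (B *ᵥ v) := by
  rw [← mulVec_mulVec, dotProduct_mulVec, star_mulVec]

theorem expVal_conjTranspose_mul_self (B : Matrix n m ℂ) (v : m → ℂ) :
    expVal (Bᴴ * B) v = ∑ i, ‖(B *ᵥ v) i‖ ^ 2 := by
  rw [expVal, dotProduct_conjTranspose_mul_self_mulVec, star_dotProduct_self_eq,
    Complex.ofReal_re]

theorem expVal_nonneg {τ : Matrix m m ℂ} (hτ : τ.PosSemidef) (v : m → ℂ) : 0 ≤ expVal τ v :=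
  hτ.re_dotProduct_nonneg v

theorem ofReal_expVal {τ : Matrix m m ℂ} (hτ : τ.PosSemidef) (v : m → ℂ) :
    (expVal τ v : ℂ) = star v ⬝ᵥ (τ *ᵥ v) := by
  obtain ⟨B, rfl⟩ := exists_eq_conjTranspose_mul_self hτ
  rw [expVal_conjTranspose_mul_self, dotProduct_conjTranspose_mul_self_mulVec,
    star_dotProduct_self_eq]

theorem norm_dotProduct_mulVec_sq_le {τ : Matrix m m ℂ} (hτ : τ.PosSemidef) (u v : m → ℂ) :
    ‖star u ⬝ᵥ (τ *ᵥ v)‖ ^ 2 ≤ expVal τ u * expVal τ v := by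
  obtain ⟨B, rfl⟩ := exists_eq_conjTranspose_mul_self hτ
  rw [expVal_conjTranspose_mul_self, expVal_conjTranspose_mul_self,
    dotProduct_conjTranspose_mul_self_mulVec]
  exact norm_star_dotProduct_sq_le _ _

theorem sqrt_expVal_sum_le {τ : Matrix m m ℂ} (hτ : τ.PosSemidef) (s : Finset ι)
    (v : ι → m → ℂ) : √(expVal τ (∑ i ∈ s, v i)) ≤ ∑ i ∈ s, √(expVal τ (v i)) := by
  obtain ⟨B, rfl⟩ := exists_eq_conjTranspose_mul_self hτ
  have hnorm (x : m → ℂ) : √(expVal (Bᴴ * B) x) = ‖WithLp.toLp 2 (B *ᵥ x)‖ := by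
    rw [expVal_conjTranspose_mul_self, EuclideanSpace.norm_eq]
  simp only [hnorm, Matrix.mulVec_sum, WithLp.toLp_sum]
  exact norm_sum_le _ _

theorem expVal_sum (s : Finset ι) (τ : ι → Matrix m m ℂ) (v : m → ℂ) :
    expVal (∑ i ∈ s, τ i) v = ∑ i ∈ s, expVal (τ i) v := by
  simp only [expVal, Matrix.sum_mulVec, dotProduct_sum, Complex.re_sum]

theorem expVal_sub (τ τ' : Matrix m m ℂ) (v : m → ℂ) :
    expVal (τ - τ') v = expVal τ v - expVal τ' v := by
  simp only [expVal, Matrix.sub_mulVec, dotProduct_sub, Complex.sub_re]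

theorem expVal_smul (t : ℝ) (τ : Matrix m m ℂ) (v : m → ℂ) :
    expVal ((t : ℂ) • τ) v = t * expVal τ v := by
  simp only [expVal, Matrix.smul_mulVec, dotProduct_smul, smul_eq_mul, Complex.re_ofReal_mul]

theorem posSemidef_sub_of_expVal_le {ρ τ : Matrix m m ℂ} (hρ : ρ.PosSemidef)
    (hτ : τ.PosSemidef) (h : ∀ z, expVal ρ z ≤ expVal τ z) : (τ - ρ).PosSemidef := by
  refine PosSemidef.of_dotProduct_mulVec_nonneg (hτ.isHermitian.sub hρ.isHermitian) fun z => ?_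
  rw [Matrix.sub_mulVec, dotProduct_sub, ← ofReal_expVal hρ, ← ofReal_expVal hτ,
    ← Complex.ofReal_sub]
  exact_mod_cast sub_nonneg.2 (h z)

theorem expVal_le_of_posSemidef_sub {ρ τ : Matrix m m ℂ} (h : (τ - ρ).PosSemidef) (z : m → ℂ) :
    expVal ρ z ≤ expVal τ z := by
  rw [← sub_nonneg, ← expVal_sub]
  exact expVal_nonneg h z

theorem pureState_mulVec (v z : m → ℂ) : pureState v *ᵥ z = (star v ⬝ᵥ z) • v := by
  rw [pureState, vecMulVec_mulVec, op_smul_eq_smul]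

theorem expVal_pureState (v z : m → ℂ) : expVal (pureState v) z = ‖star v ⬝ᵥ z‖ ^ 2 := by
  rw [expVal, pureState_mulVec, dotProduct_smul, star_dotProduct z v, smul_eq_mul,
    RCLike.star_def, Complex.mul_conj, Complex.ofReal_re, Complex.normSq_eq_norm_sq]

omit [Fintype m] in
theorem pureState_posSemidef [Finite m] (v : m → ℂ) : (pureState v).PosSemidef :=
  posSemidef_vecMulVec_self_star v

theorem trace_pureState (v : m → ℂ) : (pureState v).trace.re = ∑ p, ‖v p‖ ^ 2 := by
  rw [pureState, trace_vecMulVec, dotProduct_comm, star_dotProduct_self_eq, Complex.ofReal_re]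

omit [Fintype m] in
theorem pureState_ofReal_smul (c : ℝ) (v : m → ℂ) :
    pureState ((c : ℂ) • v) = ((c ^ 2 : ℝ) : ℂ) • pureState v := by
  ext i j
  simp only [pureState, vecMulVec_apply, Matrix.smul_apply, Pi.smul_apply, Pi.star_apply,
    smul_eq_mul, star_mul', RCLike.star_def, Complex.conj_ofReal, Complex.ofReal_pow]
  ring

end QuadraticForm

section OrthogonalFamily

variable {m ι κ : Type*} [Fintype m]

/-- The vectors `v i` are pairwise orthogonal, and `c i` is the squared norm of `v i`; vectors
of norm zero are allowed. -/
structure IsOrthogonal (v : ι → m → ℂ) (c : ι → ℝ) : Prop where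
  normSq (i : ι) : star (v i) ⬝ᵥ v i = c i
  orthogonal : Pairwise fun i j => star (v i) ⬝ᵥ v j = 0

namespace IsOrthogonal

variable {v : ι → m → ℂ} {c : ι → ℝ}

theorem dotProduct_eq [DecidableEq ι] (h : IsOrthogonal v c) (i j : ι) :
    star (v i) ⬝ᵥ v j = if i = j then (c i : ℂ) else 0 := by
  split_ifs with hij
  · rw [← hij, h.normSq]
  · exact h.orthogonal hij

theorem of_dotProduct_eq [DecidableEq ι]
    (h : ∀ i j, star (v i) ⬝ᵥ v j = if i = j then (c i : ℂ) else 0) : IsOrthogonal v c :=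
  ⟨fun i => by simp [h], fun i j hij => by simp [h, hij]⟩

theorem comp {f : κ → ι} (h : IsOrthogonal v c) (hf : f.Injective) :
    IsOrthogonal (v ∘ f) (c ∘ f) :=
  ⟨fun i => h.normSq (f i), fun _ _ hij => h.orthogonal (hf.ne hij)⟩

theorem sum_norm_sq (h : IsOrthogonal v c) (i : ι) : ∑ p, ‖v i p‖ ^ 2 = c i := by
  have := h.normSq i
  rw [star_dotProduct_self_eq] at this
  exact_mod_cast this

theorem nonneg (h : IsOrthogonal v c) (i : ι) : 0 ≤ c i := by
  rw [← h.sum_norm_sq i]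
  positivity

theorem eq_zero_of_normSq_eq_zero (h : IsOrthogonal v c) {i : ι} (hi : c i = 0) : v i = 0 := by
  have hnorm := h.normSq i
  rwa [hi, Complex.ofReal_zero, dotProduct_star_self_eq_zero] at hnorm

theorem smul (h : IsOrthogonal v c) (r : ι → ℝ) :
    IsOrthogonal (fun i => (r i : ℂ) • v i) (fun i => r i ^ 2 * c i) := by
  refine ⟨fun i => ?_, fun i j hij => ?_⟩
  · rw [star_smul, smul_dotProduct, dotProduct_smul, h.normSq, RCLike.star_def,
      Complex.conj_ofReal]
    push_cast
    simp only [smul_eq_mul]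
    ring
  · simp only [star_smul, smul_dotProduct, dotProduct_smul, h.orthogonal hij, smul_zero]

theorem star_sum_dotProduct_sum [Fintype ι] (h : IsOrthogonal v c) (y z : ι → ℂ) :
    star (∑ i, y i • v i) ⬝ᵥ ∑ i, z i • v i = ∑ i, star (y i) * z i * c i := by
  classical
  simp [star_sum, sum_dotProduct, dotProduct_sum, h.dotProduct_eq, mul_assoc, mul_left_comm]

theorem sum_norm_dotProduct_sq_le [Fintype ι] (h : IsOrthogonal v c) (hc : ∀ i, c i ≤ 1)
    (z : m → ℂ) : ∑ i, ‖star (v i) ⬝ᵥ z‖ ^ 2 ≤ ∑ p, ‖z p‖ ^ 2 := by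
  set a : ι → ℂ := fun i => star (v i) ⬝ᵥ z
  set y : m → ℂ := ∑ i, a i • v i with hy
  have hyz : star y ⬝ᵥ z = ((∑ i, ‖a i‖ ^ 2 : ℝ) : ℂ) := by
    simp only [hy, star_sum, sum_dotProduct, star_smul, smul_dotProduct, smul_eq_mul,
      RCLike.star_def, Complex.ofReal_sum, Complex.ofReal_pow]
    exact Finset.sum_congr rfl fun i _ => Complex.conj_mul' (a i)
  have hyy : star y ⬝ᵥ y = ((∑ i, ‖a i‖ ^ 2 * c i : ℝ) : ℂ) := by
    simp only [hy, h.star_sum_dotProduct_sum, RCLike.star_def, Complex.conj_mul',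
      Complex.ofReal_sum, Complex.ofReal_mul, Complex.ofReal_pow]
  have hpos : 0 ≤ (star (z - y) ⬝ᵥ (z - y)).re := by
    rw [star_dotProduct_self_eq, Complex.ofReal_re]
    positivity
  rw [star_sub, sub_dotProduct, dotProduct_sub, dotProduct_sub, star_dotProduct z y, hyz, hyy,
    star_dotProduct_self_eq, RCLike.star_def, Complex.conj_ofReal] at hpos
  simp only [Complex.sub_re, Complex.ofReal_re] at hpos
  have hle : ∑ i, ‖a i‖ ^ 2 * c i ≤ ∑ i, ‖a i‖ ^ 2 :=
    Finset.sum_le_sum fun i _ => mul_le_of_le_one_right (by positivity) (hc i)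
  linarith

theorem sum_expVal_le_trace [Fintype ι] (h : IsOrthogonal v c) (hc : ∀ i, c i ≤ 1)
    {τ : Matrix m m ℂ} (hτ : τ.PosSemidef) : ∑ i, expVal τ (v i) ≤ τ.trace.re := by
  obtain ⟨B, rfl⟩ := exists_eq_conjTranspose_mul_self hτ
  have htrace : (Bᴴ * B).trace.re = ∑ k, ∑ p, ‖star (B k) p‖ ^ 2 := by
    rw [trace_mul_comm, trace, Complex.re_sum]
    refine Finset.sum_congr rfl fun k _ => ?_
    rw [show (B * Bᴴ).diag k = star (star (B k)) ⬝ᵥ star (B k) by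
      simp [Matrix.mul_apply, dotProduct], star_dotProduct_self_eq, Complex.ofReal_re]
  simp only [expVal_conjTranspose_mul_self]
  rw [Finset.sum_comm, htrace]
  refine Finset.sum_le_sum fun k _ => le_trans (le_of_eq ?_)
    (h.sum_norm_dotProduct_sq_le hc (star (B k)))
  refine Finset.sum_congr rfl fun i _ => ?_
  rw [star_dotProduct_star, norm_star, mulVec]

/-- The vectors `v i` scaled to norm one; where `v i = 0` the value is `0`, since `0⁻¹ = 0`. -/
noncomputable def normalize (v : ι → m → ℂ) (c : ι → ℝ) (i : ι) : m → ℂ :=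
  (((√(c i))⁻¹ : ℝ) : ℂ) • v i

theorem normalize_isOrthogonal (h : IsOrthogonal v c) :
    IsOrthogonal (normalize v c) fun i => (c i)⁻¹ * c i := by
  have hsq (i : ι) : (c i)⁻¹ = (√(c i))⁻¹ ^ 2 := by rw [inv_pow, Real.sq_sqrt (h.nonneg i)]
  simp only [hsq]
  exact h.smul fun i => (√(c i))⁻¹

theorem sqrt_smul_normalize (h : IsOrthogonal v c) (i : ι) :
    ((√(c i) : ℝ) : ℂ) • normalize v c i = v i := by
  rcases (h.nonneg i).eq_or_lt with hi | hi
  · rw [normalize, h.eq_zero_of_normSq_eq_zero hi.symm, smul_zero, smul_zero]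
  · rw [normalize, smul_smul, ← Complex.ofReal_mul, mul_inv_cancel₀ (Real.sqrt_ne_zero'.2 hi),
      Complex.ofReal_one, one_smul]

theorem superposition [Fintype κ] {a : κ × ι → m → ℂ} (ha : IsOrthogonal a 1)
    {w : κ → ι → ℝ} (hw : ∀ k i, 0 ≤ w k i) :
    IsOrthogonal (fun i => ∑ k, ((√(w k i) : ℝ) : ℂ) • a (k, i)) fun i => ∑ k, w k i := by
  classical
  refine .of_dotProduct_eq fun i j => ?_
  rw [star_sum, sum_dotProduct]
  simp only [dotProduct_sum, star_smul, smul_dotProduct, dotProduct_smul, ha.dotProduct_eq,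
    Prod.mk.injEq]
  by_cases hij : i = j
  · subst hij
    simp only [and_true, if_true, smul_eq_mul, mul_ite, mul_zero, Finset.sum_ite_eq,
      Finset.mem_univ, RCLike.star_def, Complex.conj_ofReal, Complex.ofReal_sum]
    refine Finset.sum_congr rfl fun k _ => ?_
    rw [Pi.one_apply, Complex.ofReal_one, mul_one, ← Complex.ofReal_mul,
      Real.mul_self_sqrt (hw k i)]
  · simp [hij]

end IsOrthogonal

end OrthogonalFamily

section Fidelity

variable {m ι : Type*} [Fintype m]

omit [Fintype m] in
theorem ofReal_smul_posSemidef {M : Matrix m m ℂ} (hM : M.PosSemidef) {t : ℝ} (ht : 0 ≤ t) :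
    ((t : ℂ) • M).PosSemidef :=
  hM.smul (by exact_mod_cast ht)

theorem trace_mul_pureState (N : Matrix m m ℂ) (v : m → ℂ) :
    (N * pureState v).trace.re = expVal N v := by
  rw [pureState, mul_vecMulVec, trace_vecMulVec, dotProduct_comm, expVal]

theorem mul_pureState_mul_conjTranspose (N : Matrix m m ℂ) (v : m → ℂ) :
    N * pureState v * Nᴴ = pureState (N *ᵥ v) := by
  rw [pureState, mul_vecMulVec, vecMulVec_mul, pureState, star_mulVec]

namespace IsOrthogonal

variable {v : ι → m → ℂ} {c : ι → ℝ}

theorem sum_smul_pureState_mulVec [Fintype ι] (h : IsOrthogonal v c) (a : ι → ℂ) (i : ι) :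
    (∑ j, a j • pureState (v j)) *ᵥ v i = (a i * c i) • v i := by
  classical
  simp [sum_mulVec, smul_mulVec, pureState_mulVec, h.dotProduct_eq, mul_smul]

theorem sum_smul_pureState_mul [Fintype ι] (h : IsOrthogonal v c) (a b : ι → ℂ) :
    (∑ i, a i • pureState (v i)) * ∑ i, b i • pureState (v i) =
      ∑ i, (a i * b i * c i) • pureState (v i) := by
  rw [Finset.mul_sum]
  refine Finset.sum_congr rfl fun i _ => ?_
  rw [mul_smul_comm, pureState, mul_vecMulVec, h.sum_smul_pureState_mulVec, smul_vecMulVec,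
    smul_smul]
  ring_nf

theorem smul_normalize_normSq (h : IsOrthogonal v c) (i : ι) :
    (((c i)⁻¹ * c i : ℝ) : ℂ) • normalize v c i = normalize v c i := by
  rcases eq_or_ne (c i) 0 with hi | hi
  · rw [normalize, h.eq_zero_of_normSq_eq_zero hi, smul_zero, smul_zero]
  · rw [inv_mul_cancel₀ hi, Complex.ofReal_one, one_smul]

theorem smul_pureState_normalize_normSq (h : IsOrthogonal v c) (i : ι) :
    (((c i)⁻¹ * c i : ℝ) : ℂ) • pureState (normalize v c i) = pureState (normalize v c i) := by
  rw [pureState, ← smul_vecMulVec, h.smul_normalize_normSq]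

end IsOrthogonal

theorem isOrthogonal_unit (v : m → ℂ) :
    IsOrthogonal (fun _ : Unit => v) fun _ => ∑ p, ‖v p‖ ^ 2 :=
  ⟨fun _ => star_dotProduct_self_eq v, fun _ _ h => absurd rfl h⟩

variable [DecidableEq m]

theorem psdSqrt_posSemidef (M : Matrix m m ℂ) : (psdSqrt M).PosSemidef := by
  open scoped MatrixOrder in
  exact nonneg_iff_posSemidef.1 (CFC.sqrt_nonneg M)

theorem psdSqrt_mul_self {M : Matrix m m ℂ} (hM : M.PosSemidef) : psdSqrt M * psdSqrt M = M := by
  open scoped MatrixOrder in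
  exact CFC.sqrt_mul_sqrt_self M (nonneg_iff_posSemidef.2 hM)

theorem conjTranspose_psdSqrt_mul_self {M : Matrix m m ℂ} (hM : M.PosSemidef) :
    (psdSqrt M)ᴴ * psdSqrt M = M := by
  rw [(psdSqrt_posSemidef M).isHermitian.eq, psdSqrt_mul_self hM]

theorem psdSqrt_eq {M N : Matrix m m ℂ} (hN : N.PosSemidef) (h : N * N = M) :
    psdSqrt M = N := by
  open scoped MatrixOrder in
  exact CFC.sqrt_unique h (nonneg_iff_posSemidef.2 hN)

/-- `|M| := √(Mᴴ M)` is supported on the span of the `e i`, and `‖|M| e‖ = ‖M e‖`. -/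
theorem traceNorm_le_sum_of_mul_sum_pureState_eq [Fintype ι] {e : ι → m → ℂ}
    (he : ∀ i, ∑ p, ‖e i p‖ ^ 2 ≤ 1) {M : Matrix m m ℂ}
    (hM : M * ∑ i, pureState (e i) = M) :
    traceNorm M ≤ ∑ i, √(∑ p, ‖(M *ᵥ e i) p‖ ^ 2) := by
  set N := psdSqrt (Mᴴ * M)
  have hNM : Nᴴ * N = Mᴴ * M :=
    conjTranspose_psdSqrt_mul_self (posSemidef_conjTranspose_mul_self M)
  have hsupport : N * ∑ i, pureState (e i) = N := by
    have hzero : Nᴴ * N * (1 - ∑ i, pureState (e i)) = 0 := by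
      rw [hNM, mul_assoc, mul_sub, mul_one, hM, sub_self, mul_zero]
    have := (conjTranspose_mul_self_mul_eq_zero N _).1 hzero
    rw [mul_sub, mul_one, sub_eq_zero] at this
    exact this.symm
  have htrace : traceNorm M = ∑ i, expVal N (e i) := by
    calc traceNorm M = (N * ∑ i, pureState (e i)).trace.re := by rw [hsupport, traceNorm]
      _ = ∑ i, expVal N (e i) := by
          simp only [Finset.mul_sum, trace_sum, Complex.re_sum, trace_mul_pureState]
  rw [htrace]
  refine Finset.sum_le_sum fun i _ => (le_abs_self _).trans (Real.abs_le_sqrt ?_)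
  have hcs : ‖star (e i) ⬝ᵥ (N *ᵥ e i)‖ ^ 2 ≤ 1 * ∑ p, ‖(N *ᵥ e i) p‖ ^ 2 :=
    (norm_star_dotProduct_sq_le _ _).trans (by gcongr; exact he i)
  rwa [one_mul, ← ofReal_expVal (psdSqrt_posSemidef _), Complex.norm_real, Real.norm_eq_abs,
    sq_abs, ← expVal_conjTranspose_mul_self N, hNM, expVal_conjTranspose_mul_self] at hcs

theorem IsOrthogonal.psdSqrt_sum_pureState [Fintype ι] {v : ι → m → ℂ} {c : ι → ℝ}
    (h : IsOrthogonal v c) :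
    psdSqrt (∑ i, pureState (v i)) = ∑ i, ((√(c i) : ℝ) : ℂ) • pureState (normalize v c i) := by
  refine psdSqrt_eq (posSemidef_sum _ fun i _ =>
    ofReal_smul_posSemidef (pureState_posSemidef _) (Real.sqrt_nonneg _)) ?_
  rw [h.normalize_isOrthogonal.sum_smul_pureState_mul]
  refine Finset.sum_congr rfl fun i _ => ?_
  rw [mul_smul, h.smul_pureState_normalize_normSq, ← Complex.ofReal_mul, ← sq,
    ← pureState_ofReal_smul, h.sqrt_smul_normalize]

theorem IsOrthogonal.fidelity_sum_pureState_le [Fintype ι] {v : ι → m → ℂ} {c : ι → ℝ}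
    (h : IsOrthogonal v c) {τ : Matrix m m ℂ} (hτ : τ.PosSemidef) :
    fidelity τ (∑ i, pureState (v i)) ≤ ∑ i, √(expVal τ (v i)) := by
  have hsupport : psdSqrt (∑ i, pureState (v i)) * ∑ i, pureState (normalize v c i) =
      psdSqrt (∑ i, pureState (v i)) := by
    have hmul := h.normalize_isOrthogonal.sum_smul_pureState_mul
      (fun i => ((√(c i) : ℝ) : ℂ)) 1
    simpa only [Pi.one_apply, one_smul, mul_one, mul_smul, h.smul_pureState_normalize_normSq,
      ← h.psdSqrt_sum_pureState] using hmul
  have happly (i : ι) : psdSqrt (∑ i, pureState (v i)) *ᵥ normalize v c i = v i := by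
    rw [h.psdSqrt_sum_pureState, h.normalize_isOrthogonal.sum_smul_pureState_mulVec, mul_smul,
      h.smul_normalize_normSq, h.sqrt_smul_normalize]
  have hle := traceNorm_le_sum_of_mul_sum_pureState_eq (e := normalize v c)
    (M := psdSqrt τ * psdSqrt (∑ i, pureState (v i)))
    (fun i => (h.normalize_isOrthogonal.sum_norm_sq i).trans_le inv_mul_le_one)
    (by rw [mul_assoc, hsupport])
  simpa only [← mulVec_mulVec, happly, ← expVal_conjTranspose_mul_self,
    conjTranspose_psdSqrt_mul_self hτ, fidelity] using hle

theorem psdSqrt_pureState (v : m → ℂ) :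
    psdSqrt (pureState v) = (((√(∑ p, ‖v p‖ ^ 2))⁻¹ : ℝ) : ℂ) • pureState v := by
  have := (isOrthogonal_unit v).psdSqrt_sum_pureState
  rw [Fintype.sum_unique, Fintype.sum_unique] at this
  rw [this, IsOrthogonal.normalize, pureState_ofReal_smul, smul_smul, ← Complex.ofReal_mul]
  congr 2
  rcases (Real.sqrt_nonneg (∑ p, ‖v p‖ ^ 2)).eq_or_lt with hv | hv
  · simp [← hv]
  · field_simp

theorem traceNorm_eq_of_conjTranspose_mul_self_eq_pureState {M : Matrix m m ℂ} {u : m → ℂ}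
    (h : Mᴴ * M = pureState u) : traceNorm M = √(∑ p, ‖u p‖ ^ 2) := by
  rw [traceNorm, h, psdSqrt_pureState, trace_smul, smul_eq_mul, Complex.re_ofReal_mul,
    trace_pureState, inv_mul_eq_div, Real.div_sqrt]

theorem fidelity_pureState (v w : m → ℂ) :
    fidelity (pureState v) (pureState w) = ‖star v ⬝ᵥ w‖ := by
  set r := √(∑ p, ‖w p‖ ^ 2) with hr
  have hsq : r ^ 2 = ∑ p, ‖w p‖ ^ 2 := Real.sq_sqrt (by positivity)
  have hgram : (psdSqrt (pureState v) * psdSqrt (pureState w))ᴴ *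
      (psdSqrt (pureState v) * psdSqrt (pureState w)) = pureState (psdSqrt (pureState w) *ᵥ v) := by
    rw [← mul_pureState_mul_conjTranspose, conjTranspose_mul,
      (psdSqrt_posSemidef (pureState w)).isHermitian.eq, mul_assoc, ← mul_assoc _ᴴ,
      conjTranspose_psdSqrt_mul_self (pureState_posSemidef v), mul_assoc]
  have happly : psdSqrt (pureState w) *ᵥ v = ((r⁻¹ : ℝ) : ℂ) • (star w ⬝ᵥ v) • w := by
    rw [psdSqrt_pureState, smul_mulVec, pureState_mulVec]
  rw [fidelity, traceNorm_eq_of_conjTranspose_mul_self_eq_pureState hgram, happly]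
  have hnorm : ∑ p, ‖(((r⁻¹ : ℝ) : ℂ) • (star w ⬝ᵥ v) • w) p‖ ^ 2 =
      (r⁻¹ * r * ‖star v ⬝ᵥ w‖) ^ 2 := by
    simp only [Pi.smul_apply, smul_eq_mul, norm_mul, Complex.norm_real, Real.norm_eq_abs, mul_pow,
      sq_abs, ← Finset.mul_sum, ← hsq, star_dotProduct w v, norm_star]
    ring
  rw [hnorm, Real.sqrt_sq (by positivity)]
  rcases (Real.sqrt_nonneg (∑ p, ‖w p‖ ^ 2)).eq_or_lt with hw | hw
  · have hcs := norm_star_dotProduct_sq_le v w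
    rw [← hsq, hr, ← hw, zero_pow two_ne_zero, mul_zero] at hcs
    rw [pow_eq_zero_iff two_ne_zero |>.1 (hcs.antisymm (sq_nonneg _)), mul_zero]
  · rw [inv_mul_cancel₀ hw.ne', one_mul]

end Fidelity

section ClassicalFuchsVanDeGraaf

variable {ι : Type*} [Fintype ι] {p q : ι → ℝ}

/-- Cauchy–Schwarz for `|p - q| = |√p - √q| (√p + √q)`. -/
theorem sum_abs_sub_sq_le (hp : ∀ i, 0 ≤ p i) (hq : ∀ i, 0 ≤ q i) :
    (∑ i, |p i - q i|) ^ 2 ≤ (∑ i, (p i + q i)) ^ 2 - 4 * (∑ i, √(p i * q i)) ^ 2 := by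
  have hfactor (i : ι) : |p i - q i| = |√(p i) - √(q i)| * (√(p i) + √(q i)) := by
    rw [← abs_of_nonneg (by positivity : 0 ≤ √(p i) + √(q i)), ← abs_mul]
    congr 1
    linear_combination Real.mul_self_sqrt (hq i) - Real.mul_self_sqrt (hp i)
  have hsub : ∑ i, |√(p i) - √(q i)| ^ 2 = ∑ i, (p i + q i) - 2 * ∑ i, √(p i * q i) := by
    rw [Finset.mul_sum, ← Finset.sum_sub_distrib]
    refine Finset.sum_congr rfl fun i _ => ?_
    rw [sq_abs, Real.sqrt_mul (hp i)]
    linear_combination Real.mul_self_sqrt (hq i) + Real.mul_self_sqrt (hp i)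
  have hadd : ∑ i, (√(p i) + √(q i)) ^ 2 = ∑ i, (p i + q i) + 2 * ∑ i, √(p i * q i) := by
    rw [Finset.mul_sum, ← Finset.sum_add_distrib]
    refine Finset.sum_congr rfl fun i _ => ?_
    rw [Real.sqrt_mul (hp i)]
    linear_combination Real.mul_self_sqrt (hq i) + Real.mul_self_sqrt (hp i)
  calc (∑ i, |p i - q i|) ^ 2
      = (∑ i, |√(p i) - √(q i)| * (√(p i) + √(q i))) ^ 2 := by simp only [hfactor]
    _ ≤ (∑ i, |√(p i) - √(q i)| ^ 2) * ∑ i, (√(p i) + √(q i)) ^ 2 :=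
        Finset.sum_mul_sq_le_sq_mul_sq _ _ _
    _ = _ := by
        rw [hsub, hadd]
        ring

theorem sum_posPart_sq_le_of_sum_eq_one (hp : ∀ i, 0 ≤ p i) (hq : ∀ i, 0 ≤ q i)
    (hp_sum : ∑ i, p i = 1) (hq_sum : ∑ i, q i = 1) :
    (∑ i, max (p i - q i) 0) ^ 2 ≤ 1 - (∑ i, √(p i * q i)) ^ 2 := by
  have hmax (i : ι) : max (p i - q i) 0 = (|p i - q i| + (p i - q i)) / 2 := by
    grind
  have hhalf : ∑ i, max (p i - q i) 0 = (∑ i, |p i - q i|) / 2 := by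
    simp only [hmax]
    rw [← Finset.sum_div, Finset.sum_add_distrib, Finset.sum_sub_distrib, hp_sum, hq_sum,
      sub_self, add_zero]
  have hle := sum_abs_sub_sq_le hp hq
  rw [Finset.sum_add_distrib, hp_sum, hq_sum] at hle
  rw [hhalf]
  linarith

theorem sum_posPart_sq_le (hp : ∀ i, 0 ≤ p i) (hq : ∀ i, 0 ≤ q i)
    (hp_sum : ∑ i, p i ≤ 1) (hq_sum : ∑ i, q i ≤ 1) :
    (∑ i, max (p i - q i) 0) ^ 2 ≤
      1 - (∑ i, √(p i * q i) + √((1 - ∑ i, p i) * (1 - ∑ i, q i))) ^ 2 := by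
  have h := sum_posPart_sq_le_of_sum_eq_one (ι := Option ι)
    (p := fun o => o.elim (1 - ∑ i, p i) p) (q := fun o => o.elim (1 - ∑ i, q i) q)
    (fun o => by cases o <;> simp [hp, hp_sum]) (fun o => by cases o <;> simp [hq, hq_sum])
    (by simp [Fintype.sum_option]) (by simp [Fintype.sum_option])
  simp only [Fintype.sum_option, Option.elim] at h
  rw [add_comm (√_)] at h
  refine le_trans ?_ h
  have : 0 ≤ ∑ i, max (p i - q i) 0 := Finset.sum_nonneg fun i _ => le_max_right _ _
  gcongr
  exact le_add_of_nonneg_left (le_max_right _ _)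

/-- The filter truncates `p` to `min p q`. -/
theorem exists_filter_of_sqrt_one_sub_sq_le (hp : ∀ i, 0 ≤ p i) (hq : ∀ i, 0 ≤ q i)
    (hp_sum : ∑ i, p i ≤ 1) (hq_sum : ∑ i, q i ≤ 1) {ε : ℝ}
    (hε : √(1 - (∑ i, √(p i * q i) + √((1 - ∑ i, p i) * (1 - ∑ i, q i))) ^ 2) ≤ ε) :
    ∃ f : ι → ℝ, (∀ i, f i ∈ Set.Icc 0 1) ∧ (∀ i, p i * f i ≤ q i) ∧
      ∑ i, p i * (1 - f i) ≤ ε := by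
  have hmin (i : ι) : p i * min 1 (q i / p i) = min (p i) (q i) := by
    rcases (hp i).eq_or_lt with hi | hi
    · rw [← hi, zero_mul, min_eq_left (hq i)]
    · rw [mul_min_of_nonneg _ _ hi.le, mul_one, mul_div_cancel₀ _ hi.ne']
  refine ⟨fun i => min 1 (q i / p i),
    fun i => ⟨le_min zero_le_one (div_nonneg (hq i) (hp i)), min_le_left _ _⟩,
    fun i => (hmin i).trans_le (min_le_right _ _), ?_⟩
  have hsub (i : ι) : p i * (1 - min 1 (q i / p i)) = max (p i - q i) 0 := by
    rw [mul_sub, mul_one, hmin]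
    grind
  simp only [hsub]
  refine le_trans (Real.le_sqrt_of_sq_le ?_) hε
  exact sum_posPart_sq_le hp hq hp_sum hq_sum

end ClassicalFuchsVanDeGraaf

section TensorVec

variable {m n ι κ : Type*}

/-- The product vector `u ⊗ v`. -/
def tensorVec (u : m → ℂ) (v : n → ℂ) : m × n → ℂ := fun p => u p.1 * v p.2

theorem tensorVec_smul (a : ℂ) (u : m → ℂ) (v : n → ℂ) :
    tensorVec u (a • v) = a • tensorVec u v := by
  ext p
  simp only [tensorVec, Pi.smul_apply, smul_eq_mul]
  ring

theorem tensorVec_sum (s : Finset ι) (u : m → ℂ) (v : ι → n → ℂ) :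
    tensorVec u (∑ i ∈ s, v i) = ∑ i ∈ s, tensorVec u (v i) := by
  ext p
  simp only [tensorVec, Finset.sum_apply, Finset.mul_sum]

variable [Fintype m] [Fintype n]

theorem star_tensorVec_dotProduct_tensorVec (u u' : m → ℂ) (v v' : n → ℂ) :
    star (tensorVec u v) ⬝ᵥ tensorVec u' v' = (star u ⬝ᵥ u') * (star v ⬝ᵥ v') := by
  simp only [dotProduct, tensorVec, Pi.star_apply, star_mul', Fintype.sum_prod_type,
    Finset.sum_mul_sum]
  exact Finset.sum_congr rfl fun i _ => Finset.sum_congr rfl fun j _ => by ring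

theorem star_tensorVec_dotProduct (u : m → ℂ) (v : n → ℂ) (z : m × n → ℂ) :
    star (tensorVec u v) ⬝ᵥ z = star u ⬝ᵥ fun i => star v ⬝ᵥ fun j => z (i, j) := by
  simp only [dotProduct, tensorVec, Pi.star_apply, star_mul', Fintype.sum_prod_type,
    Finset.mul_sum, mul_assoc]

variable [DecidableEq m]

theorem one_kronecker_mulVec_tensorVec (σ : Matrix n n ℂ) (u : m → ℂ) (v : n → ℂ) :
    ((1 : Matrix m m ℂ) ⊗ₖ σ) *ᵥ tensorVec u v = tensorVec u (σ *ᵥ v) := by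
  ext ⟨i, j⟩
  simp only [mulVec, dotProduct, kroneckerMap_apply, tensorVec, Fintype.sum_prod_type,
    one_apply]
  rw [Finset.sum_eq_single i (fun b _ hb => by simp [hb.symm]) (by simp), Finset.mul_sum]
  exact Finset.sum_congr rfl fun k _ => by rw [if_pos rfl]; ring

theorem expVal_one_kronecker (σ : Matrix n n ℂ) (z : m × n → ℂ) :
    expVal ((1 : Matrix m m ℂ) ⊗ₖ σ) z = ∑ i, expVal σ fun j => z (i, j) := by
  simp only [expVal, ← Complex.re_sum]
  congr 1
  simp only [dotProduct, mulVec, kroneckerMap_apply, Fintype.sum_prod_type, one_apply,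
    Pi.star_apply]
  refine Finset.sum_congr rfl fun i _ => Finset.sum_congr rfl fun j _ => ?_
  rw [Finset.sum_eq_single i (fun b _ hb => by simp [hb.symm]) (by simp)]
  simp

omit [Fintype m] [Fintype n] in
theorem one_kronecker_posSemidef [Finite m] [Finite n] {σ : Matrix n n ℂ} (hσ : σ.PosSemidef) :
    ((1 : Matrix m m ℂ) ⊗ₖ σ).PosSemidef := by
  classical exact PosSemidef.one.kronecker hσ

theorem IsOrthogonal.expVal_one_kronecker_sum_tensorVec [Fintype ι] {ξ : ι → m → ℂ}
    (hξ : IsOrthogonal ξ 1) (σ : Matrix n n ℂ) (z : ι → ℂ) (b : ι → n → ℂ) :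
    expVal ((1 : Matrix m m ℂ) ⊗ₖ σ) (∑ i, z i • tensorVec (ξ i) (b i)) =
      ∑ i, ‖z i‖ ^ 2 * expVal σ (b i) := by
  classical
  have hdiag (i : ι) :
      z i * ∑ j, star (z j) * ((star (ξ j) ⬝ᵥ ξ i) * (star (b j) ⬝ᵥ (σ *ᵥ b i))) =
        ((‖z i‖ ^ 2 : ℝ) : ℂ) * (star (b i) ⬝ᵥ (σ *ᵥ b i)) := by
    simp only [hξ.dotProduct_eq, ite_mul, zero_mul, mul_ite, mul_zero, Finset.sum_ite_eq',
      Finset.mem_univ, if_true, Pi.one_apply, Complex.ofReal_one, one_mul]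
    rw [← mul_assoc, RCLike.star_def, Complex.mul_conj', Complex.ofReal_pow]
  simp only [expVal, mulVec_sum, mulVec_smul, one_kronecker_mulVec_tensorVec, star_sum, star_smul,
    sum_dotProduct, dotProduct_sum, smul_dotProduct, dotProduct_smul, smul_eq_mul,
    star_tensorVec_dotProduct_tensorVec, hdiag, Complex.re_sum, Complex.re_ofReal_mul]

end TensorVec

section Filter

variable {Ω S T K O m : Type*} [Fintype m]

theorem sum_norm_sq_div_le {τ : Matrix m m ℂ} (hτ : τ.PosSemidef) {A : Finset Ω}
    {e : Ω → m → ℂ} {s : Ω → ℝ} (hs : ∀ i, 0 ≤ s i) {t : ℝ} (ht : 0 ≤ t)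
    (hbound : ∀ z : Ω → ℂ, expVal τ (∑ i ∈ A, z i • e i) ≤ t * ∑ i ∈ A, ‖z i‖ ^ 2 * s i)
    (u : m → ℂ) : ∑ i ∈ A, ‖star (e i) ⬝ᵥ (τ *ᵥ u)‖ ^ 2 / s i ≤ t * expVal τ u := by
  set y : Ω → ℂ := fun i => star (e i) ⬝ᵥ (τ *ᵥ u)
  set Y := ∑ i ∈ A, ‖y i‖ ^ 2 / s i with hY
  have hY_nonneg : 0 ≤ Y := Finset.sum_nonneg fun i _ => div_nonneg (sq_nonneg _) (hs i)
  set w : m → ℂ := ∑ i ∈ A, (y i / s i) • e i with hw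
  have hpair : star w ⬝ᵥ (τ *ᵥ u) = (Y : ℂ) := by
    simp only [hw, star_sum, sum_dotProduct, star_smul, smul_dotProduct, hY, Complex.ofReal_sum]
    refine Finset.sum_congr rfl fun i _ => ?_
    change star (y i / s i) * y i = _
    rw [RCLike.star_def, map_div₀, Complex.conj_ofReal, div_mul_eq_mul_div, Complex.conj_mul']
    push_cast
    rfl
  have hself : expVal τ w ≤ t * Y := by
    refine (hbound _).trans_eq ?_
    congr 1
    refine Finset.sum_congr rfl fun i _ => ?_
    rw [norm_div, Complex.norm_real, Real.norm_of_nonneg (hs i)]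
    rcases eq_or_ne (s i) 0 with hi | hi
    · simp [hi]
    · field_simp
  have hcs : Y * Y ≤ t * expVal τ u * Y := by
    have := norm_dotProduct_mulVec_sq_le hτ w u
    rw [hpair, Complex.norm_real, Real.norm_of_nonneg hY_nonneg, sq] at this
    calc Y * Y ≤ expVal τ w * expVal τ u := this
      _ ≤ t * Y * expVal τ u := by gcongr; exact expVal_nonneg hτ u
      _ = t * expVal τ u * Y := by ring
  rcases hY_nonneg.eq_or_lt with h | h
  · rw [← h]
    exact mul_nonneg ht (expVal_nonneg hτ u)
  · exact le_of_mul_le_mul_right hcs h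

/-- With `u = ∑ √p e`, the weights are `q i = |⟨e i|τ|u⟩|² / ⟨u|τ|u⟩` and `r = q / s`. -/
theorem exists_weights_of_expVal_sum_le {τ : Matrix m m ℂ} (hτ : τ.PosSemidef) {A : Finset Ω}
    (e : Ω → m → ℂ) {s : Ω → ℝ} (hs : ∀ i, 0 ≤ s i) {t : ℝ} (ht : 0 ≤ t)
    (hbound : ∀ z : Ω → ℂ, expVal τ (∑ i ∈ A, z i • e i) ≤ t * ∑ i ∈ A, ‖z i‖ ^ 2 * s i)
    {p : Ω → ℝ} (hp : ∀ i, 0 ≤ p i) :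
    ∃ q r : Ω → ℝ, (∀ i, 0 ≤ q i) ∧ (∀ i, 0 ≤ r i) ∧ (∀ i, q i ≤ expVal τ (e i)) ∧
      √(expVal τ (∑ i ∈ A, ((√(p i) : ℝ) : ℂ) • e i)) ≤ ∑ i ∈ A, √(p i * q i) ∧
      (∀ i ∈ A, q i ≤ r i * s i) ∧ ∑ i ∈ A, r i ≤ t := by
  classical
  set u : m → ℂ := ∑ i ∈ A, ((√(p i) : ℝ) : ℂ) • e i with hu
  set y : Ω → ℂ := fun i => star (e i) ⬝ᵥ (τ *ᵥ u) with hy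
  have hE : 0 ≤ expVal τ u := expVal_nonneg hτ u
  have hq_nonneg (i : Ω) : 0 ≤ ‖y i‖ ^ 2 / expVal τ u := by positivity
  have hq_le (i : Ω) : ‖y i‖ ^ 2 / expVal τ u ≤ expVal τ (e i) :=
    div_le_of_le_mul₀ hE (expVal_nonneg hτ _) (norm_dotProduct_mulVec_sq_le hτ (e i) u)
  have hE_le : expVal τ u ≤ ∑ i ∈ A, √(p i) * ‖y i‖ := by
    have hsum : star u ⬝ᵥ (τ *ᵥ u) = ∑ i ∈ A, ((√(p i) : ℝ) : ℂ) * y i := by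
      have hstar : star u = ∑ i ∈ A, ((√(p i) : ℝ) : ℂ) • star (e i) := by
        simp only [hu, star_sum, star_smul, RCLike.star_def, Complex.conj_ofReal]
      simp only [hstar, sum_dotProduct, smul_dotProduct, smul_eq_mul, hy]
    rw [expVal, hsum]
    refine (Complex.re_le_norm _).trans ((norm_sum_le _ _).trans_eq ?_)
    simp [abs_of_nonneg]
  refine ⟨fun i => ‖y i‖ ^ 2 / expVal τ u, fun i => ‖y i‖ ^ 2 / expVal τ u / s i, hq_nonneg,
    fun i => div_nonneg (hq_nonneg i) (hs i), hq_le, ?_, fun i hi => ?_, ?_⟩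
  · have hsqrt (i : Ω) : √(p i * (‖y i‖ ^ 2 / expVal τ u)) = √(p i) * ‖y i‖ / √(expVal τ u) := by
      rw [Real.sqrt_mul (hp i), Real.sqrt_div (sq_nonneg _), Real.sqrt_sq (norm_nonneg _),
        mul_div_assoc]
    simp only [hsqrt, ← Finset.sum_div]
    calc √(expVal τ u) = expVal τ u / √(expVal τ u) := Real.div_sqrt.symm
      _ ≤ _ := by gcongr
  · rcases eq_or_ne (s i) 0 with hi0 | hi0
    · have hsingle := hbound (Pi.single i 1)
      rw [Finset.sum_eq_single i (fun j _ hj => by simp [hj]) (fun h => absurd hi h),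
        Finset.sum_eq_single i (fun j _ hj => by simp [hj]) (fun h => absurd hi h),
        Pi.single_eq_same, one_smul, hi0, mul_zero, mul_zero] at hsingle
      exact (hq_le i).trans (by rw [hi0, mul_zero]; exact hsingle)
    · rw [div_mul_cancel₀ _ hi0]
  · simp only [div_right_comm _ (expVal τ u), ← Finset.sum_div]
    exact div_le_of_le_mul₀ hE ht (sum_norm_sq_div_le hτ hs ht hbound u)

theorem IsOrthogonal.sum_fiber [Fintype Ω] [DecidableEq K] {e : Ω → m → ℂ} {d : Ω → ℝ}
    (he : IsOrthogonal e d) (g : Ω → K) (z : Ω → ℂ) :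
    IsOrthogonal (fun k => ∑ x with g x = k, z x • e x)
      fun k => ∑ x with g x = k, ‖z x‖ ^ 2 * d x := by
  classical
  refine .of_dotProduct_eq fun k k' => ?_
  simp only [star_sum, sum_dotProduct, dotProduct_sum, star_smul, smul_dotProduct,
    dotProduct_smul, he.dotProduct_eq, smul_eq_mul, mul_ite, mul_zero, Finset.sum_ite_eq',
    Finset.mem_filter, Finset.mem_univ, true_and]
  split_ifs with hk
  · subst hk
    rw [Complex.ofReal_sum]
    refine Finset.sum_congr rfl fun x hx => ?_
    rw [if_pos (Finset.mem_filter.1 hx).2, ← mul_assoc, RCLike.star_def, Complex.mul_conj']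
    push_cast
    rfl
  · refine Finset.sum_eq_zero fun x hx => if_neg ?_
    rw [(Finset.mem_filter.1 hx).2]
    exact Ne.symm hk

theorem sqrt_expVal_sum_fiber_le [Fintype Ω] [Fintype T] [Fintype K] [DecidableEq T]
    [DecidableEq K] {τ : Matrix m m ℂ} (hτ : τ.PosSemidef) (κ : Ω → T) (c : T → K)
    (v : Ω → m → ℂ) :
    ∑ k, √(expVal τ (∑ x with c (κ x) = k, v x)) ≤ ∑ y, √(expVal τ (∑ x with κ x = y, v x)) := by
  have hfiber (k : K) : ∑ x with c (κ x) = k, v x = ∑ y with c y = k, ∑ x with κ x = y, v x := by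
    rw [← Finset.sum_fiberwise_of_maps_to (s := {x | c (κ x) = k}) (t := {y | c y = k}) (g := κ)
      (by simp)]
    refine Finset.sum_congr rfl fun y hy => Finset.sum_congr ?_ fun _ _ => rfl
    ext x
    simp only [Finset.mem_filter, Finset.mem_univ, true_and] at hy ⊢
    exact ⟨And.right, fun hx => ⟨by rw [hx, hy], hx⟩⟩
  calc ∑ k, √(expVal τ (∑ x with c (κ x) = k, v x))
      ≤ ∑ k, ∑ y with c y = k, √(expVal τ (∑ x with κ x = y, v x)) :=
        Finset.sum_le_sum fun k _ => by rw [hfiber]; exact sqrt_expVal_sum_le hτ _ _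
    _ = _ := Finset.sum_fiberwise _ _ _

end Filter

section SmoothingFilter

variable {Ω S T K O m n : Type*}

theorem fidelity_nonneg [Fintype m] [DecidableEq m] (ρ σ : Matrix m m ℂ) : 0 ≤ fidelity ρ σ :=
  (Complex.nonneg_iff.1 (psdSqrt_posSemidef _).trace_nonneg).1

theorem IsOrthogonal.sum_trace_pureState_sum_fiber [Fintype m] [Fintype Ω] [Fintype K]
    [DecidableEq K] {e : Ω → m → ℂ} {d : Ω → ℝ} (he : IsOrthogonal e d) {p : Ω → ℝ}
    (hp : ∀ x, 0 ≤ p x) (g : Ω → K) :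
    (∑ k, pureState (∑ x with g x = k, ((√(p x) : ℝ) : ℂ) • e x)).trace.re =
      ∑ x, p x * d x := by
  rw [trace_sum, Complex.re_sum, ← Finset.sum_fiberwise _ g]
  refine Finset.sum_congr rfl fun k _ => ?_
  rw [trace_pureState, (he.sum_fiber g _).sum_norm_sq]
  refine Finset.sum_congr rfl fun x _ => ?_
  rw [Complex.norm_real, Real.norm_of_nonneg (Real.sqrt_nonneg _), Real.sq_sqrt (hp x)]

theorem exists_weights_of_expVal_sum_fiber_le [Fintype m] [DecidableEq m] [Fintype Ω] [Finite T]
    [Fintype K] [DecidableEq T] [DecidableEq K] {τ : Matrix m m ℂ} (hτ : τ.PosSemidef)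
    {e : Ω → m → ℂ} {d : Ω → ℝ} (he : IsOrthogonal e d) {s : Ω → ℝ} (hs : ∀ x, 0 ≤ s x)
    {t : ℝ} (ht : 0 ≤ t) (κ : Ω → T) (c : T → K)
    (hbound : ∀ (y : T) (z : Ω → ℂ), expVal τ (∑ x with κ x = y, z x • e x) ≤
      t * ∑ x with κ x = y, ‖z x‖ ^ 2 * s x)
    {p : Ω → ℝ} (hp : ∀ x, 0 ≤ p x) :
    ∃ q r : Ω → ℝ, (∀ x, 0 ≤ q x) ∧ (∀ x, 0 ≤ r x) ∧ (∀ x, q x ≤ expVal τ (e x)) ∧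
      fidelity τ (∑ k, pureState (∑ x with c (κ x) = k, ((√(p x) : ℝ) : ℂ) • e x)) ≤
        ∑ x, √(p x * q x) ∧
      (∀ x, q x ≤ r x * s x) ∧ ∀ y, ∑ x with κ x = y, r x ≤ t := by
  have := Fintype.ofFinite T
  choose q r hq hr hqe hfid hqr hrt using fun y =>
    exists_weights_of_expVal_sum_le hτ e hs ht (hbound y) hp
  refine ⟨fun x => q (κ x) x, fun x => r (κ x) x, fun x => hq _ x, fun x => hr _ x,
    fun x => hqe _ x, ?_, fun x => hqr _ x (by simp), fun y => ?_⟩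
  · calc fidelity τ (∑ k, pureState (∑ x with c (κ x) = k, ((√(p x) : ℝ) : ℂ) • e x))
        ≤ ∑ k, √(expVal τ (∑ x with c (κ x) = k, ((√(p x) : ℝ) : ℂ) • e x)) :=
          (he.sum_fiber (fun x => c (κ x)) _).fidelity_sum_pureState_le hτ
      _ ≤ ∑ y, √(expVal τ (∑ x with κ x = y, ((√(p x) : ℝ) : ℂ) • e x)) :=
          sqrt_expVal_sum_fiber_le hτ κ c _
      _ ≤ ∑ y, ∑ x with κ x = y, √(p x * q (κ x) x) := by
          refine Finset.sum_le_sum fun y _ =>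
            (hfid y).trans_eq (Finset.sum_congr rfl fun x hx => ?_)
          rw [(Finset.mem_filter.1 hx).2]
      _ = ∑ x, √(p x * q (κ x) x) := Finset.sum_fiberwise _ _ _
  · refine le_of_eq_of_le (Finset.sum_congr rfl fun x hx => ?_) (hrt y)
    simp only [(Finset.mem_filter.1 hx).2]

/-- A filter `f` on the labels `Ω` of the state `∑ p x |x⟩⟨x|` that loses weight at most `ε`, with
a certificate `(s, r)` that the filtered state is bounded by `t`: the label `x` is seen as `π x` by
the conditioning system and as `κ x` by the environment. -/
structure FilterBound [Fintype Ω] [Fintype S] [DecidableEq T] (π : Ω → S) (κ : Ω → T) (p : Ω → ℝ)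
    (ε t : ℝ) (f : Ω → ℝ) (s : S → ℝ) (r : Ω → ℝ) : Prop where
  filter_nonneg : ∀ x, 0 ≤ f x
  filter_le_one : ∀ x, f x ≤ 1
  loss_le : ∑ x, p x * (1 - f x) ≤ ε
  state_nonneg : ∀ a, 0 ≤ s a
  sum_state_le_one : ∑ a, s a ≤ 1
  rate_nonneg : ∀ x, 0 ≤ r x
  sum_rate_le : ∀ y, ∑ x with κ x = y, r x ≤ t
  filtered_le : ∀ x, p x * f x ≤ r x * s (π x)

theorem exists_filterBound_of_expVal_sum_fiber_le [Fintype m] [DecidableEq m] [Fintype Ω]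
    [Fintype S] [Finite T] [Fintype K] [DecidableEq T] [DecidableEq K] {τ : Matrix m m ℂ}
    (hτ : IsSubState τ) {e : Ω → m → ℂ} {d : Ω → ℝ} (he : IsOrthogonal e d) (hd : ∀ x, d x ≤ 1)
    {s : S → ℝ} (hs : ∀ a, 0 ≤ s a) (hs_sum : ∑ a, s a ≤ 1) {t : ℝ} (ht : 0 ≤ t)
    (π : Ω → S) (κ : Ω → T) (c : T → K)
    (hbound : ∀ (y : T) (z : Ω → ℂ), expVal τ (∑ x with κ x = y, z x • e x) ≤
      t * ∑ x with κ x = y, ‖z x‖ ^ 2 * s (π x))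
    {p : Ω → ℝ} (hp : ∀ x, 0 ≤ p x) (hp_sum : ∑ x, p x ≤ 1) (hpd : ∀ x, p x * d x = p x) {ε : ℝ}
    (hε : purifiedDistance τ
      (∑ k, pureState (∑ x with c (κ x) = k, ((√(p x) : ℝ) : ℂ) • e x)) ≤ ε) :
    ∃ f r, FilterBound π κ p ε t f s r := by
  obtain ⟨q, r, hq, hr, hqe, hfid, hqr, hrt⟩ :=
    exists_weights_of_expVal_sum_fiber_le hτ.1 he (fun x => hs (π x)) ht κ c hbound hp
  have hq_sum : ∑ x, q x ≤ τ.trace.re :=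
    (Finset.sum_le_sum fun x _ => hqe x).trans (he.sum_expVal_le_trace hd hτ.1)
  have hdist : √(1 - (∑ x, √(p x * q x) + √((1 - ∑ x, p x) * (1 - ∑ x, q x))) ^ 2) ≤ ε := by
    refine le_trans ?_ hε
    rw [purifiedDistance, generalizedFidelity, he.sum_trace_pureState_sum_fiber hp,
      Finset.sum_congr rfl fun x _ => hpd x, mul_comm (1 - τ.trace.re)]
    have := fidelity_nonneg τ
      (∑ k, pureState (∑ x with c (κ x) = k, ((√(p x) : ℝ) : ℂ) • e x))
    gcongr
  obtain ⟨f, hf, hfq, hloss⟩ := exists_filter_of_sqrt_one_sub_sq_le hp hq hp_sum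
    (hq_sum.trans hτ.2) hdist
  exact ⟨f, r, ⟨fun x => (hf x).1, fun x => (hf x).2, hloss, hs, hs_sum, hr, hrt,
    fun x => (hfq x).trans (hqr x)⟩⟩

theorem IsOrthogonal.tensorVec_of_fiber [Fintype m] [Fintype n] {π : Ω → S} {ξ : Ω → m → ℂ}
    (hξ : ∀ a, IsOrthogonal (fun x : {x // π x = a} => ξ x) 1) {β : S → n → ℂ} {d : S → ℝ}
    (hβ : IsOrthogonal β d) :
    IsOrthogonal (fun x => tensorVec (ξ x) (β (π x))) fun x => d (π x) := by
  refine ⟨fun x => ?_, fun x x' hx => ?_⟩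
  · have hone := (hξ (π x)).normSq ⟨x, rfl⟩
    dsimp only at hone
    rw [star_tensorVec_dotProduct_tensorVec, hone, hβ.normSq, Pi.one_apply, Complex.ofReal_one,
      one_mul]
  · dsimp only
    rw [star_tensorVec_dotProduct_tensorVec]
    by_cases hπ : π x = π x'
    · have hzero := (hξ (π x')).orthogonal (i := ⟨x, hπ⟩) (j := ⟨x', rfl⟩)
        (fun h => hx (congrArg Subtype.val h))
      dsimp only at hzero
      rw [hzero, zero_mul]
    · rw [hβ.orthogonal hπ, mul_zero]

theorem expVal_one_kronecker_sum_fiber [Fintype m] [DecidableEq m] [Fintype n] [Fintype Ω]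
    [DecidableEq T] {κ : Ω → T} {ξ : Ω → m → ℂ} {y : T}
    (hξ : IsOrthogonal (fun x : {x // κ x = y} => ξ x) 1) (σ : Matrix n n ℂ) (z : Ω → ℂ)
    (b : Ω → n → ℂ) :
    expVal ((1 : Matrix m m ℂ) ⊗ₖ σ) (∑ x with κ x = y, z x • tensorVec (ξ x) (b x)) =
      ∑ x with κ x = y, ‖z x‖ ^ 2 * expVal σ (b x) := by
  rw [Finset.sum_subtype _ (p := fun x => κ x = y) (by simp),
    Finset.sum_subtype _ (p := fun x => κ x = y) (by simp)]
  exact hξ.expVal_one_kronecker_sum_tensorVec σ (fun x => z x) fun x => b x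

theorem sum_pureState_sqrt_smul [Fintype O] {q : O → ℝ} (hq : ∀ o, 0 ≤ q o)
    (v : m → ℂ) :
    ∑ o, pureState (((√(q o) : ℝ) : ℂ) • v) = pureState (((√(∑ o, q o) : ℝ) : ℂ) • v) := by
  simp only [pureState_ofReal_smul, Real.sq_sqrt (hq _),
    Real.sq_sqrt (Finset.sum_nonneg fun o _ => hq o), Complex.ofReal_sum, Finset.sum_smul]

/-- The state of the vectors `ξ x ⊗ β x` that is left of the superposition of all labels `(x, o)`
with weights `w x o` after tracing out an environment that sees `κ x` and `o`. -/
noncomputable def labelState [Fintype Ω] [Fintype T] [DecidableEq T] [Fintype O] (κ : Ω → T)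
    (w : Ω → O → ℝ) (ξ : Ω → m → ℂ) (β : Ω → n → ℂ) : Matrix (m × n) (m × n) ℂ :=
  ∑ y, ∑ o, pureState (∑ x with κ x = y, ((√(w x o) : ℝ) : ℂ) • tensorVec (ξ x) (β x))

section LabelState

variable [Fintype Ω] [Fintype T] [Fintype O] [DecidableEq T] {π : Ω → S} {κ : Ω → T}
  {ξ : Ω → m → ℂ} {b : Ω → n → ℂ} {Λ : S → ℝ} {w : Ω → O → ℝ}

theorem IsOrthogonal.labelState_normalize [Fintype n] {β : S → n → ℂ} (hβ : IsOrthogonal β Λ) :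
    labelState κ w ξ (fun x => β (π x)) =
      labelState κ (fun x o => Λ (π x) * w x o) ξ fun x => normalize β Λ (π x) := by
  refine Finset.sum_congr rfl fun y _ => Finset.sum_congr rfl fun o _ => ?_
  congr 1
  refine Finset.sum_congr rfl fun x _ => ?_
  dsimp only
  rw [← hβ.sqrt_smul_normalize (π x), tensorVec_smul, smul_smul, ← Complex.ofReal_mul,
    mul_comm, Real.sqrt_mul (hβ.nonneg _)]

theorem labelState_mul_eq_sum_pureState {p : Ω → ℝ} {q : T → O → ℝ} (hq : ∀ y o, 0 ≤ q y o) :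
    labelState κ (fun x o => p x * q (κ x) o) ξ b =
      ∑ y, pureState (∑ x with κ x = y,
        ((√(p x * ∑ o, q (κ x) o) : ℝ) : ℂ) • tensorVec (ξ x) (b x)) := by
  have hfactor (y : T) {u : T → ℝ} (hr : 0 ≤ u y) :
      ∑ x with κ x = y, ((√(p x * u (κ x)) : ℝ) : ℂ) • tensorVec (ξ x) (b x) =
        ((√(u y) : ℝ) : ℂ) • ∑ x with κ x = y, ((√(p x) : ℝ) : ℂ) • tensorVec (ξ x) (b x) := by
    rw [Finset.smul_sum]
    refine Finset.sum_congr rfl fun x hx => ?_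
    rw [(Finset.mem_filter.1 hx).2, smul_smul, mul_comm (p x), Real.sqrt_mul hr,
      Complex.ofReal_mul]
  refine Finset.sum_congr rfl fun y _ => ?_
  rw [hfactor y (u := fun y => ∑ o, q y o) (Finset.sum_nonneg fun o _ => hq y o),
    ← sum_pureState_sqrt_smul (hq y)]
  exact Finset.sum_congr rfl fun o _ => by rw [hfactor y (u := fun y => q y o) (hq y o)]

variable [Fintype m] [Fintype n]

omit [Fintype Ω] [Fintype n] in
theorem expVal_pureState_sum_sqrt_smul_le {A : Finset Ω} {w r s : Ω → ℝ} (hw : ∀ x, 0 ≤ w x)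
    (hr : ∀ x, 0 ≤ r x) (hs : ∀ x, 0 ≤ s x) (hwrs : ∀ x, w x ≤ r x * s x) (e : Ω → m → ℂ)
    (z : m → ℂ) :
    expVal (pureState (∑ x ∈ A, ((√(w x) : ℝ) : ℂ) • e x)) z ≤
      (∑ x ∈ A, r x) * ∑ x ∈ A, s x * ‖star (e x) ⬝ᵥ z‖ ^ 2 := by
  have hnorm : ‖star (∑ x ∈ A, ((√(w x) : ℝ) : ℂ) • e x) ⬝ᵥ z‖ ≤
      ∑ x ∈ A, √(w x) * ‖star (e x) ⬝ᵥ z‖ := by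
    simp only [star_sum, star_smul, sum_dotProduct, smul_dotProduct, smul_eq_mul]
    refine (norm_sum_le _ _).trans_eq (Finset.sum_congr rfl fun x _ => ?_)
    rw [norm_mul, norm_star, Complex.norm_real, Real.norm_of_nonneg (Real.sqrt_nonneg _)]
  rw [expVal_pureState]
  refine (pow_le_pow_left₀ (norm_nonneg _) hnorm 2).trans
    (Finset.sum_sq_le_sum_mul_sum_of_sq_le_mul A (fun x _ => hr x)
      (fun x _ => mul_nonneg (hs x) (sq_nonneg _)) fun x _ => ?_)
  rw [mul_pow, Real.sq_sqrt (hw x), ← mul_assoc]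
  gcongr
  exact hwrs x

theorem expVal_labelState_le {t : ℝ} {r s : Ω → ℝ} {v : T → O → ℝ} (hw : ∀ x o, 0 ≤ w x o)
    (hr : ∀ x, 0 ≤ r x) (hr_sum : ∀ y, ∑ x with κ x = y, r x ≤ t) (hs : ∀ x, 0 ≤ s x)
    (hv : ∀ y o, 0 ≤ v y o) (hv_sum : ∀ y, ∑ o, v y o ≤ 1)
    (hwrs : ∀ x o, w x o ≤ v (κ x) o * r x * s x) (z : m × n → ℂ) :
    expVal (labelState κ w ξ b) z ≤ t * ∑ x, s x * ‖star (tensorVec (ξ x) (b x)) ⬝ᵥ z‖ ^ 2 := by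
  set Z : T → ℝ := fun y =>
    ∑ x with κ x = y, s x * ‖star (tensorVec (ξ x) (b x)) ⬝ᵥ z‖ ^ 2 with hZ
  have hZ_nonneg (y : T) : 0 ≤ Z y :=
    Finset.sum_nonneg fun x _ => mul_nonneg (hs x) (sq_nonneg _)
  have hR_nonneg (y : T) : 0 ≤ ∑ x with κ x = y, r x := Finset.sum_nonneg fun x _ => hr x
  have hpure (y : T) (o : O) :
      expVal (pureState (∑ x with κ x = y, ((√(w x o) : ℝ) : ℂ) • tensorVec (ξ x) (b x))) z ≤
        v y o * ((∑ x with κ x = y, r x) * Z y) := by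
    rw [← mul_assoc]
    refine (expVal_pureState_sum_sqrt_smul_le (hw · o) (fun x => mul_nonneg (hv (κ x) o) (hr x)) hs
      (hwrs · o) _ z).trans_eq ?_
    congr 1
    rw [Finset.mul_sum]
    exact Finset.sum_congr rfl fun x hx => congrArg (v · o * r x) (Finset.mem_filter.1 hx).2
  simp only [labelState, expVal_sum]
  calc _ ≤ ∑ y, ∑ o, v y o * ((∑ x with κ x = y, r x) * Z y) :=
        Finset.sum_le_sum fun y _ => Finset.sum_le_sum fun o _ => hpure y o
    _ ≤ ∑ y, t * Z y := by
        refine Finset.sum_le_sum fun y _ => ?_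
        rw [← Finset.sum_mul]
        exact (mul_le_of_le_one_left (mul_nonneg (hR_nonneg y) (hZ_nonneg y)) (hv_sum y)).trans
          (mul_le_mul_of_nonneg_right (hr_sum y) (hZ_nonneg y))
    _ = _ := by rw [← Finset.mul_sum, hZ, Finset.sum_fiberwise]

omit [Fintype m] [Fintype n] in
theorem labelState_posSemidef [Finite m] [Finite n] : (labelState κ w ξ b).PosSemidef :=
  posSemidef_sum _ fun _ _ => posSemidef_sum _ fun _ _ => pureState_posSemidef _

theorem IsOrthogonal.isSubState_sum_smul_pureState [Fintype S] {α : S → n → ℂ} {d s : S → ℝ}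
    (hα : IsOrthogonal α d) (hd : ∀ a, d a ≤ 1) (hs : ∀ a, 0 ≤ s a) (hs_sum : ∑ a, s a ≤ 1) :
    IsSubState (∑ a, (s a : ℂ) • pureState (α a)) := by
  refine ⟨posSemidef_sum _ fun a _ => ofReal_smul_posSemidef (pureState_posSemidef _) (hs a),
    le_trans ?_ hs_sum⟩
  rw [trace_sum, Complex.re_sum]
  refine Finset.sum_le_sum fun a _ => ?_
  rw [trace_smul, smul_eq_mul, Complex.re_ofReal_mul, trace_pureState, hα.sum_norm_sq]
  exact mul_le_of_le_one_right (hs a) (hd a)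

theorem sum_mul_norm_star_tensorVec_dotProduct_sq_le [DecidableEq m] [Fintype S]
    (hξ : ∀ a, IsOrthogonal (fun x : {x // π x = a} => ξ x) 1) (α : S → n → ℂ) {s : S → ℝ}
    (hs : ∀ a, 0 ≤ s a) (z : m × n → ℂ) :
    ∑ x, s (π x) * ‖star (tensorVec (ξ x) (α (π x))) ⬝ᵥ z‖ ^ 2 ≤
      expVal ((1 : Matrix m m ℂ) ⊗ₖ ∑ a, (s a : ℂ) • pureState (α a)) z := by
  classical
  have hfiber (a : S) : ∑ x with π x = a, ‖star (tensorVec (ξ x) (α (π x))) ⬝ᵥ z‖ ^ 2 ≤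
      ∑ i, ‖star (α a) ⬝ᵥ fun j => z (i, j)‖ ^ 2 := by
    rw [Finset.sum_subtype _ (p := fun x => π x = a) (by simp)]
    refine le_of_eq_of_le (Finset.sum_congr rfl fun x _ => ?_)
      ((hξ a).sum_norm_dotProduct_sq_le (fun _ => le_rfl) fun i => star (α a) ⬝ᵥ fun j => z (i, j))
    rw [star_tensorVec_dotProduct, x.2]
  rw [← Finset.sum_fiberwise _ π, expVal_one_kronecker]
  simp only [expVal_sum, expVal_smul, expVal_pureState]
  rw [Finset.sum_comm]
  refine Finset.sum_le_sum fun a _ => ?_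
  rw [← Finset.mul_sum]
  refine le_of_eq_of_le ?_ (mul_le_mul_of_nonneg_left (hfiber a) (hs a))
  rw [Finset.mul_sum]
  exact Finset.sum_congr rfl fun x hx => by rw [(Finset.mem_filter.1 hx).2]

end LabelState

variable [Fintype m] [DecidableEq m] [Fintype n] [Fintype Ω] [Fintype S] [Fintype K] [Fintype O]
  [DecidableEq T] [DecidableEq K] {π : Ω → S} {κ : Ω → T} {c : T → K} {ξ : Ω → m → ℂ}
  {Λ : S → ℝ} {χ : Ω → ℝ} {q : K → O → ℝ}

theorem exists_filterBound_of_posSemidef_sub [DecidableEq n] [Finite T] {β : S → n → ℂ}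
    (hξπ : ∀ a, IsOrthogonal (fun x : {x // π x = a} => ξ x) 1)
    (hξκ : ∀ y, IsOrthogonal (fun x : {x // κ x = y} => ξ x) 1)
    (hβ : IsOrthogonal β Λ) (hχ : ∀ x, 0 ≤ χ x) (hq : ∀ k o, 0 ≤ q k o)
    (h_sum : ∑ x, Λ (π x) * χ x * ∑ o, q (c (κ x)) o ≤ 1)
    {τ : Matrix (m × n) (m × n) ℂ} {σ : Matrix n n ℂ} (hτ : IsSubState τ) (hσ : IsSubState σ)
    {t : ℝ} (ht : 0 ≤ t) (hle : ((t : ℂ) • ((1 : Matrix m m ℂ) ⊗ₖ σ) - τ).PosSemidef) {ε : ℝ}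
    (hε : purifiedDistance τ (labelState (fun x => c (κ x)) (fun x o => χ x * q (c (κ x)) o) ξ
      (fun x => β (π x))) ≤ ε) :
    ∃ f s r, FilterBound π κ (fun x => Λ (π x) * χ x * ∑ o, q (c (κ x)) o) ε t f s r := by
  have hβ' := hβ.normalize_isOrthogonal
  have hd (a : S) : (Λ a)⁻¹ * Λ a ≤ 1 := inv_mul_le_one
  have hp (x : Ω) : 0 ≤ Λ (π x) * χ x * ∑ o, q (c (κ x)) o :=
    mul_nonneg (mul_nonneg (hβ.nonneg _) (hχ x)) (Finset.sum_nonneg fun o _ => hq _ o)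
  have hpd (x : Ω) : Λ (π x) * χ x * (∑ o, q (c (κ x)) o) * ((Λ (π x))⁻¹ * Λ (π x)) =
      Λ (π x) * χ x * ∑ o, q (c (κ x)) o := by
    rcases eq_or_ne (Λ (π x)) 0 with h | h
    · simp [h]
    · rw [inv_mul_cancel₀ h, mul_one]
  have hbound (y : T) (z : Ω → ℂ) :
      expVal τ (∑ x with κ x = y, z x • tensorVec (ξ x) (IsOrthogonal.normalize β Λ (π x))) ≤
        t * ∑ x with κ x = y, ‖z x‖ ^ 2 * expVal σ (IsOrthogonal.normalize β Λ (π x)) := by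
    refine (expVal_le_of_posSemidef_sub hle _).trans_eq ?_
    rw [expVal_smul, expVal_one_kronecker_sum_fiber (hξκ y)]
  rw [hβ.labelState_normalize] at hε
  simp only [← mul_assoc] at hε
  rw [labelState_mul_eq_sum_pureState hq] at hε
  obtain ⟨f, r, h⟩ := exists_filterBound_of_expVal_sum_fiber_le hτ
    (IsOrthogonal.tensorVec_of_fiber hξπ hβ') (fun x => hd (π x)) (fun a => expVal_nonneg hσ.1 _)
    ((hβ'.sum_expVal_le_trace hd hσ.1).trans hσ.2) ht π κ c hbound hp h_sum hpd hε
  exact ⟨f, _, r, h⟩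

omit [Fintype K] [DecidableEq K] in
theorem FilterBound.exists_posSemidef_sub_labelState [Fintype T] {α : S → n → ℂ}
    (hξ : ∀ a, IsOrthogonal (fun x : {x // π x = a} => ξ x) 1) (hα : IsOrthogonal α Λ)
    (hχ : ∀ x, 0 ≤ χ x) (hq : ∀ k o, 0 ≤ q k o) {ε t : ℝ} {f : Ω → ℝ} {s : S → ℝ} {r : Ω → ℝ}
    (h : FilterBound π κ (fun x => Λ (π x) * χ x * ∑ o, q (c (κ x)) o) ε t f s r) (ht : 0 ≤ t)
    {g : Ω → O → ℝ} (hg : ∀ x o, 0 ≤ g x o) (hgf : ∀ x o, g x o ≤ f x) :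
    ∃ σ : Matrix n n ℂ, IsSubState σ ∧ ((t : ℂ) • ((1 : Matrix m m ℂ) ⊗ₖ σ) -
      labelState κ (fun x o => χ x * q (c (κ x)) o * g x o) ξ
        fun x => α (π x)).PosSemidef := by
  have hα' := hα.normalize_isOrthogonal
  have hσ := hα'.isSubState_sum_smul_pureState (fun _ => inv_mul_le_one) h.state_nonneg
    h.sum_state_le_one
  have hQ (k : K) : 0 ≤ ∑ o, q k o := Finset.sum_nonneg fun o _ => hq k o
  have hweight (x : Ω) (o : O) : Λ (π x) * (χ x * q (c (κ x)) o * g x o) ≤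
      q (c (κ x)) o / (∑ o, q (c (κ x)) o) * r x * s (π x) := by
    have hqQ : q (c (κ x)) o / (∑ o, q (c (κ x)) o) * ∑ o, q (c (κ x)) o = q (c (κ x)) o :=
      div_mul_cancel_of_imp fun hQ0 =>
        (Finset.sum_eq_zero_iff_of_nonneg fun o _ => hq _ o).1 hQ0 o (Finset.mem_univ o)
    calc Λ (π x) * (χ x * q (c (κ x)) o * g x o)
        ≤ Λ (π x) * (χ x * q (c (κ x)) o * f x) := by
          have := hα.nonneg (π x)
          have := hχ x
          have := hq (c (κ x)) o
          gcongr
          exact hgf x o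
      _ = q (c (κ x)) o / (∑ o, q (c (κ x)) o) *
            (Λ (π x) * χ x * (∑ o, q (c (κ x)) o) * f x) := by
          conv_lhs => rw [← hqQ]
          ring
      _ ≤ q (c (κ x)) o / (∑ o, q (c (κ x)) o) * (r x * s (π x)) :=
          mul_le_mul_of_nonneg_left (h.filtered_le x) (div_nonneg (hq _ o) (hQ _))
      _ = _ := (mul_assoc _ _ _).symm
  refine ⟨_, hσ, posSemidef_sub_of_expVal_le labelState_posSemidef
    (ofReal_smul_posSemidef (one_kronecker_posSemidef hσ.1) ht) fun z => ?_⟩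
  rw [hα.labelState_normalize, expVal_smul]
  refine (expVal_labelState_le (fun x o => ?_) h.rate_nonneg h.sum_rate_le
    (fun x => h.state_nonneg (π x)) (v := fun y o => q (c y) o / ∑ o, q (c y) o)
    (fun y o => div_nonneg (hq _ o) (hQ _)) (fun y => ?_) hweight z).trans
    (mul_le_mul_of_nonneg_left
      (sum_mul_norm_star_tensorVec_dotProduct_sq_le hξ _ h.state_nonneg z) ht)
  · exact mul_nonneg (hα.nonneg _) (mul_nonneg (mul_nonneg (hχ x) (hq _ o)) (hg x o))
  · rw [← Finset.sum_div]
    exact div_self_le_one _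

end SmoothingFilter

section MinEntropy

variable {m n : Type*} [Fintype m] [DecidableEq m] [Fintype n]

theorem exists_of_lt_smoothCondMinEntropy [DecidableEq n] {ε x : ℝ}
    {ρ : Matrix (m × n) (m × n) ℂ} (h : (x : EReal) < smoothCondMinEntropy ε ρ) :
    ∃ τ σ, IsSubState τ ∧ purifiedDistance τ ρ ≤ ε ∧ IsSubState σ ∧
      ((((2 : ℝ) ^ (-x) : ℝ) : ℂ) • ((1 : Matrix m m ℂ) ⊗ₖ σ) - τ).PosSemidef := by
  obtain ⟨_, ⟨τ, hτ, hdist, rfl⟩, hlt⟩ := lt_sSup_iff.1 h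
  obtain ⟨_, ⟨σ, hσ, rfl⟩, hlt⟩ := lt_sSup_iff.1 hlt
  rw [condMinEntropyRel, EReal.lt_neg_comm, sInf_lt_iff] at hlt
  obtain ⟨_, ⟨t, rfl, ht⟩, hlt⟩ := hlt
  rw [← EReal.coe_neg, EReal.coe_lt_coe_iff] at hlt
  have hpow : (2 : ℝ) ^ t ≤ 2 ^ (-x) := Real.rpow_le_rpow_of_exponent_le one_le_two hlt.le
  have hsum :=
    (ofReal_smul_posSemidef (one_kronecker_posSemidef (m := m) hσ.1) (sub_nonneg.2 hpow)).add ht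
  rw [Complex.ofReal_sub, sub_smul, sub_add_sub_cancel] at hsum
  exact ⟨τ, σ, hτ, hdist, hσ, hsum⟩

theorem le_condMinEntropy_of_forall_lt {ρ : Matrix (m × n) (m × n) ℂ} {H : EReal}
    (h : ∀ x : ℝ, (x : EReal) < H → ∃ σ, IsSubState σ ∧
      ((((2 : ℝ) ^ (-x) : ℝ) : ℂ) • ((1 : Matrix m m ℂ) ⊗ₖ σ) - ρ).PosSemidef) :
    H ≤ condMinEntropy ρ := by
  refine EReal.ge_of_forall_gt_iff_ge.1 fun x hx => ?_
  obtain ⟨σ, hσ, hx⟩ := h x hx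
  refine le_trans ?_ (le_sSup ⟨σ, hσ, rfl⟩)
  rw [condMinEntropyRel, EReal.le_neg, ← EReal.coe_neg]
  exact sInf_le ⟨-x, rfl, hx⟩

theorem condMinEntropy_zero : condMinEntropy (0 : Matrix (m × n) (m × n) ℂ) = ⊤ :=
  top_le_iff.1 <| le_condMinEntropy_of_forall_lt fun _ _ =>
    ⟨0, ⟨PosSemidef.zero, by simp⟩, by simpa using PosSemidef.zero⟩

end MinEntropy

section UniformFilter

variable {Ω S T : Type*} [Fintype Ω] [Fintype S] [DecidableEq T] {π : Ω → S} {κ : Ω → T}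
  {p : Ω → ℝ} {ε t t' : ℝ} {f : Ω → ℝ} {s : S → ℝ} {r : Ω → ℝ}

theorem FilterBound.mono (h : FilterBound π κ p ε t f s r) (ht : t ≤ t') :
    FilterBound π κ p ε t' f s r :=
  { h with sum_rate_le := fun y => (h.sum_rate_le y).trans ht }

theorem isClosed_setOf_filterBound (π : Ω → S) (κ : Ω → T) (p : Ω → ℝ) (ε t : ℝ) :
    IsClosed {x : (Ω → ℝ) × (S → ℝ) × (Ω → ℝ) | FilterBound π κ p ε t x.1 x.2.1 x.2.2} := by
  have hset : {x : (Ω → ℝ) × (S → ℝ) × (Ω → ℝ) | FilterBound π κ p ε t x.1 x.2.1 x.2.2} =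
      {x | (∀ i, 0 ≤ x.1 i) ∧ (∀ i, x.1 i ≤ 1) ∧ (∑ i, p i * (1 - x.1 i) ≤ ε) ∧
        (∀ a, 0 ≤ x.2.1 a) ∧ (∑ a, x.2.1 a ≤ 1) ∧ (∀ i, 0 ≤ x.2.2 i) ∧
        (∀ y, ∑ i with κ i = y, x.2.2 i ≤ t) ∧ ∀ i, p i * x.1 i ≤ x.2.2 i * x.2.1 (π i)} :=
    Set.ext fun x => ⟨fun h => ⟨h.1, h.2, h.3, h.4, h.5, h.6, h.7, h.8⟩,
      fun ⟨h1, h2, h3, h4, h5, h6, h7, h8⟩ => ⟨h1, h2, h3, h4, h5, h6, h7, h8⟩⟩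
  rw [hset]
  simp only [Set.ofPred_and, Set.ofPred_forall]
  refine IsClosed.inter ?_ (IsClosed.inter ?_ (IsClosed.inter ?_ (IsClosed.inter ?_
    (IsClosed.inter ?_ (IsClosed.inter ?_ (IsClosed.inter ?_ ?_))))))
  all_goals
    repeat refine isClosed_iInter fun _ => ?_
    exact isClosed_le (by fun_prop) (by fun_prop)

theorem isCompact_setOf_filterBound (π : Ω → S) (κ : Ω → T) (p : Ω → ℝ) (ε t : ℝ) :
    IsCompact {x : (Ω → ℝ) × (S → ℝ) × (Ω → ℝ) | FilterBound π κ p ε t x.1 x.2.1 x.2.2} := by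
  refine (isCompact_Icc (a := 0) (b := (1, 1, fun _ => t))).of_isClosed_subset
    (isClosed_setOf_filterBound π κ p ε t) ?_
  rintro ⟨f, s, r⟩ h
  refine ⟨⟨h.filter_nonneg, h.state_nonneg, h.rate_nonneg⟩, h.filter_le_one, fun a => ?_,
    fun x => ?_⟩
  · exact (Finset.single_le_sum (fun a _ => h.state_nonneg a) (Finset.mem_univ a)).trans
      h.sum_state_le_one
  · exact (Finset.single_le_sum (fun x _ => h.rate_nonneg x) (by simp)).trans
      (h.sum_rate_le (κ x))

/-- The certified filters for the thresholds below `H` form a directed family of compact sets. -/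
theorem exists_filterBound_forall_lt (hε : 0 ≤ ε) {H : EReal}
    (h : ∀ x : ℝ, (x : EReal) < H → ∃ f s r, FilterBound π κ p ε (2 ^ (-x)) f s r) :
    ∃ f s r, (∀ x, 0 ≤ f x) ∧ (∀ x, f x ≤ 1) ∧ ∑ x, p x * (1 - f x) ≤ ε ∧
      ∀ x : ℝ, (x : EReal) < H → FilterBound π κ p ε (2 ^ (-x)) f s r := by
  set C : {x : ℝ // (x : EReal) < H} → Set ((Ω → ℝ) × (S → ℝ) × (Ω → ℝ)) := fun x =>
    {y | FilterBound π κ p ε (2 ^ (-x.1)) y.1 y.2.1 y.2.2}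
  rcases isEmpty_or_nonempty {x : ℝ // (x : EReal) < H} with hempty | hnonempty
  · exact ⟨1, 0, 0, fun _ => zero_le_one, fun _ => le_rfl, by simpa using hε,
      fun x hx => hempty.elim ⟨x, hx⟩⟩
  · have hanti : Antitone C := fun x y hxy z hz =>
      hz.mono (Real.rpow_le_rpow_of_exponent_le one_le_two (neg_le_neg hxy))
    obtain ⟨⟨f, s, r⟩, hfsr⟩ := IsCompact.nonempty_iInter_of_directed_nonempty_isCompact_isClosed
      C hanti.directed_ge (fun x => let ⟨f, s, r, hf⟩ := h x.1 x.2; ⟨(f, s, r), hf⟩)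
      (fun x => isCompact_setOf_filterBound π κ p ε _)
      (fun x => isClosed_setOf_filterBound π κ p ε _)
    have hbound (x : {x : ℝ // (x : EReal) < H}) : FilterBound π κ p ε (2 ^ (-x.1)) f s r :=
      Set.mem_iInter.1 hfsr x
    obtain ⟨x⟩ := hnonempty
    exact ⟨f, s, r, (hbound x).filter_nonneg, (hbound x).filter_le_one, (hbound x).loss_le,
      fun x hx => hbound ⟨x, hx⟩⟩

omit [Fintype S] in
theorem exists_filter_smoothCondMinEntropy_labelState_le [Finite S] {K O m n n' : Type*} [Fintype m]
    [DecidableEq m] [Fintype n] [DecidableEq n] [Fintype n'] [Fintype T] [Fintype K]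
    [DecidableEq K] [Fintype O] {c : T → K} {ξ : Ω → m → ℂ} {α : S → n' → ℂ} {β : S → n → ℂ}
    {Λ : S → ℝ} {χ : Ω → ℝ} {q : K → O → ℝ}
    (hξπ : ∀ a, IsOrthogonal (fun x : {x // π x = a} => ξ x) 1)
    (hξκ : ∀ y, IsOrthogonal (fun x : {x // κ x = y} => ξ x) 1) (hα : IsOrthogonal α Λ)
    (hβ : IsOrthogonal β Λ) (hχ : ∀ x, 0 ≤ χ x) (hq : ∀ k o, 0 ≤ q k o)
    (h_sum : ∑ x, Λ (π x) * χ x * ∑ o, q (c (κ x)) o ≤ 1) (hε : 0 ≤ ε) :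
    ∃ f : Ω → ℝ, (∀ x, 0 ≤ f x) ∧ (∀ x, f x ≤ 1) ∧
      ∑ x, Λ (π x) * χ x * (∑ o, q (c (κ x)) o) * (1 - f x) ≤ ε ∧
      ∀ g : Ω → O → ℝ, (∀ x o, 0 ≤ g x o) → (∀ x o, g x o ≤ f x) →
        smoothCondMinEntropy ε (labelState (fun x => c (κ x)) (fun x o => χ x * q (c (κ x)) o) ξ
          fun x => β (π x)) ≤
        condMinEntropy (labelState κ (fun x o => χ x * q (c (κ x)) o * g x o) ξ
          fun x => α (π x)) := by
  have := Fintype.ofFinite S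
  obtain ⟨f, s, r, hf_nonneg, hf_le_one, hloss, hbound⟩ := exists_filterBound_forall_lt (π := π)
    (κ := κ) (p := fun x => Λ (π x) * χ x * ∑ o, q (c (κ x)) o) hε
    (H := smoothCondMinEntropy ε (labelState (fun x => c (κ x)) (fun x o => χ x * q (c (κ x)) o) ξ
      fun x => β (π x))) fun x hx => by
        obtain ⟨τ, σ, hτ, hdist, hσ, hle⟩ := exists_of_lt_smoothCondMinEntropy hx
        exact exists_filterBound_of_posSemidef_sub hξπ hξκ hβ hχ hq h_sum hτ hσ (by positivity)
          hle hdist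
  exact ⟨f, hf_nonneg, hf_le_one, hloss, fun g hg hgf => le_condMinEntropy_of_forall_lt fun x hx =>
    (hbound x hx).exists_posSemidef_sub_labelState hξπ hα hχ hq (by positivity) hg hgf⟩

end UniformFilter

section LocalBases

noncomputable instance HalfEdge.instFintype {V : Type*} [Finite V] (G : SimpleGraph V) :
    Fintype (HalfEdge G) :=
  Fintype.ofFinite _

/-- A label for every edge; both half-edges of an edge carry its label. -/
abbrev EdgeLabel {V : Type*} {G : SimpleGraph V} (D : G.edgeSet → ℕ) : Type _ :=
  (e : G.edgeSet) → Fin (D e)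

/-- Vectors `B h l` of the spaces of the half-edges `h`, labelled as the standard basis. -/
abbrev LocalFamily {V : Type*} {G : SimpleGraph V} (D : G.edgeSet → ℕ) : Type _ :=
  (h : HalfEdge G) → Fin (D h.edge) → Fin (D h.edge) → ℂ

/-- The family consists of an orthonormal basis at every half-edge. -/
def LocalFamily.IsOrthonormal {V : Type*} {G : SimpleGraph V} {D : G.edgeSet → ℕ}
    (B : LocalFamily D) : Prop :=
  ∀ h, IsOrthogonal (B h) 1

variable {V : Type*} [Fintype V] {G : SimpleGraph V} {D : G.edgeSet → ℕ} {S T : Set (HalfEdge G)}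

open scoped Classical in
/-- The product vector of `H_S` given by the label `J`. -/
noncomputable def LocalFamily.vec (B : LocalFamily D) (S : Set (HalfEdge G)) (J : EdgeLabel D) :
    Config D S → ℂ :=
  fun c => ∏ h : S, B h.1 (J h.1.edge) (c h)

/-- The product vector of `H_V` given by the label `J`. -/
noncomputable def LocalFamily.fullVec (B : LocalFamily D) (J : EdgeLabel D) : FullConfig D → ℂ :=
  fun c => ∏ h, B h (J h.edge) (c h)

open scoped Classical in
omit [Fintype V] in
theorem sum_config_prod [Finite V] (F : (h : S) → Fin (D h.1.edge) → ℂ) :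
    ∑ c : Config D S, ∏ h, F h (c h) = ∏ h, ∑ x, F h x := by
  rw [Finset.prod_univ_sum, Fintype.piFinset_univ]
  exact Fintype.sum_equiv (ι := Config D S) (κ := (h : S) → Fin (D h.1.edge)) (Equiv.refl _)
    _ _ fun _ => rfl

open scoped Classical in
omit [Fintype V] in
theorem sum_fullConfig_prod [Finite V] (F : (h : HalfEdge G) → Fin (D h.edge) → ℂ) :
    ∑ c : FullConfig D, ∏ h, F h (c h) = ∏ h, ∑ x, F h x := by
  rw [Finset.prod_univ_sum, Fintype.piFinset_univ]
  exact Fintype.sum_equiv (ι := FullConfig D) (κ := (h : HalfEdge G) → Fin (D h.edge))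
    (Equiv.refl _) _ _ fun _ => rfl

namespace LocalFamily

variable {B : LocalFamily D}

open scoped Classical in
theorem IsOrthonormal.star_vec_dotProduct (hB : B.IsOrthonormal) (S : Set (HalfEdge G))
    (J J' : EdgeLabel D) :
    star (B.vec S J) ⬝ᵥ B.vec S J' = if ∀ e ∈ HalfEdge.edge '' S, J e = J' e then 1 else 0 := by
  have hprod : star (B.vec S J) ⬝ᵥ B.vec S J' =
      ∏ h : S, if J h.1.edge = J' h.1.edge then 1 else 0 := by
    simp only [dotProduct, vec, Pi.star_apply, star_prod, ← Finset.prod_mul_distrib]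
    rw [sum_config_prod fun h x => star (B h.1 (J h.1.edge) x) * B h.1 (J' h.1.edge) x]
    refine Finset.prod_congr rfl fun h _ => ?_
    exact ((hB h.1).dotProduct_eq _ _).trans (by simp only [Pi.one_apply, Complex.ofReal_one])
  rw [hprod, Finset.prod_ite_zero]
  simp

open scoped Classical in
theorem IsOrthonormal.isOrthogonal_vec (hB : B.IsOrthonormal) {S : Set (HalfEdge G)} {ι : Type*}
    {J : ι → EdgeLabel D} (hJ : ∀ i j, (∀ e ∈ HalfEdge.edge '' S, J i e = J j e) → i = j) :
    IsOrthogonal (fun i => B.vec S (J i)) 1 := by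
  refine .of_dotProduct_eq fun i j => ?_
  rw [hB.star_vec_dotProduct]
  by_cases hij : i = j
  · subst hij
    simp
  · rw [if_neg fun h => hij (hJ i j h), if_neg hij]

open scoped Classical in
theorem IsOrthonormal.isOrthogonal_fullVec (hB : B.IsOrthonormal) :
    IsOrthogonal B.fullVec 1 := by
  refine .of_dotProduct_eq fun J J' => ?_
  have hprod : star (B.fullVec J) ⬝ᵥ B.fullVec J' =
      ∏ h : HalfEdge G, if J h.edge = J' h.edge then 1 else 0 := by
    simp only [dotProduct, fullVec, Pi.star_apply, star_prod, ← Finset.prod_mul_distrib]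
    rw [sum_fullConfig_prod fun h x => star (B h (J h.edge) x) * B h (J' h.edge) x]
    refine Finset.prod_congr rfl fun h _ => ?_
    exact ((hB h).dotProduct_eq _ _).trans (by simp only [Pi.one_apply, Complex.ofReal_one])
  have hlabel : (∀ h : HalfEdge G, J h.edge = J' h.edge) ↔ J = J' := by
    refine ⟨fun h => funext fun e => ?_, fun h _ => congrFun h _⟩
    obtain ⟨⟨x, y⟩, he⟩ := e
    exact h ⟨⟨s(x, y), he⟩, x, Sym2.mem_mk_left x y⟩
  rw [hprod, Finset.prod_ite_zero]
  simp [hlabel]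

theorem vec_congr (B : LocalFamily D) {J J' : EdgeLabel D}
    (h : ∀ e ∈ HalfEdge.edge '' S, J e = J' e) : B.vec S J = B.vec S J' := by
  ext c
  exact Finset.prod_congr rfl fun x _ => by rw [h x.1.edge ⟨x, x.2, rfl⟩]

open scoped Classical in
theorem fullVec_glue (B : LocalFamily D) (hST : Disjoint S T) (J : EdgeLabel D)
    (p : Config D S) (q : Config D T) (c : Config D (S ∪ T)ᶜ) :
    B.fullVec J (glue p q c) = B.vec S J p * B.vec T J q * B.vec (S ∪ T)ᶜ J c := by
  have hdite (U : Set (HalfEdge G)) (g : U → ℂ) :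
      ∏ h : U, g h = ∏ h, if hU : h ∈ U then g ⟨h, hU⟩ else 1 := by
    rw [Finset.prod_dite, Finset.prod_const_one, mul_one]
    exact Fintype.prod_equiv (Equiv.subtypeEquivRight fun h => by simp) _ _ fun _ => rfl
  simp only [fullVec, vec, hdite]
  rw [← Finset.prod_mul_distrib, ← Finset.prod_mul_distrib]
  refine Finset.prod_congr rfl fun h _ => ?_
  by_cases hS : h ∈ S
  · simp [glue, hS, Set.disjoint_left.1 hST hS]
  · by_cases hT : h ∈ T <;> simp [glue, hS, hT]

end LocalFamily

omit [Fintype V] in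
/-- Tracing out the complement removes the coherences between labels that differ there. -/
theorem reducedState_pureState [Finite V] {ι E : Type*} [Fintype ι] [Fintype E]
    [DecidableEq E] (d : ι → E)
    {Φ : FullConfig D → ℂ} {w : ι → Config D S × Config D T → ℂ} {z : ι → Config D (S ∪ T)ᶜ → ℂ}
    (hΦ : ∀ p c, Φ (glue p.1 p.2 c) = ∑ i, w i p * z i c)
    (hz : ∀ i j, star (z j) ⬝ᵥ z i = if d j = d i then 1 else 0) :
    reducedState S T (pureState Φ) = ∑ y, pureState (∑ i with d i = y, w i) := by
  ext p q
  have hterm (i j : ι) : ∑ c, w i p * z i c * (star (w j q) * star (z j c)) =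
      if d j = d i then w i p * star (w j q) else 0 := by
    rw [← mul_boole, ← hz, dotProduct, Finset.mul_sum]
    exact Finset.sum_congr rfl fun c _ => by rw [Pi.star_apply]; ring
  simp only [reducedState, pureState, vecMulVec_apply, Pi.star_apply, hΦ, Matrix.sum_apply,
    Finset.sum_apply, star_sum, star_mul', Finset.sum_mul_sum]
  rw [Finset.sum_comm, ← Finset.sum_fiberwise _ d]
  refine Finset.sum_congr rfl fun y _ => Finset.sum_congr rfl fun i hi => ?_
  rw [Finset.sum_comm]
  simp only [hterm, (Finset.mem_filter.1 hi).2, Finset.sum_filter]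

open scoped Classical in
theorem LocalFamily.IsOrthonormal.reducedState_pureState_sum {B : LocalFamily D}
    (hB : B.IsOrthonormal) (hST : Disjoint S T) {E : Type*} [Fintype E] [DecidableEq E]
    (d : EdgeLabel D → E) (hd : ∀ J J', d J = d J' ↔ ∀ e ∈ HalfEdge.edge '' (S ∪ T)ᶜ, J e = J' e)
    (ψ : EdgeLabel D → ℂ) :
    reducedState S T (pureState (∑ J, ψ J • B.fullVec J)) =
      ∑ y, pureState (∑ J with d J = y, ψ J • tensorVec (B.vec S J) (B.vec T J)) := by
  refine reducedState_pureState d (z := fun J => B.vec (S ∪ T)ᶜ J) (fun p c => ?_) fun J J' => ?_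
  · rw [Finset.sum_apply]
    refine Finset.sum_congr rfl fun J _ => ?_
    rw [Pi.smul_apply, Pi.smul_apply, B.fullVec_glue hST, tensorVec, smul_eq_mul, smul_eq_mul,
      mul_assoc (ψ J)]
  · simp only [hB.star_vec_dotProduct, hd]

end LocalBases

section EdgeLabels

variable {V : Type*} {G : SimpleGraph V} {D : G.edgeSet → ℕ} {N O P Q : Set G.edgeSet}

/-- Labels for the edges in `P`. -/
abbrev EdgeLabelOn {V : Type*} {G : SimpleGraph V} (D : G.edgeSet → ℕ) (P : Set G.edgeSet) :
    Type _ :=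
  (e : P) → Fin (D e.1)

/-- The part on `P ⊆ Q` of a label for the edges in `Q`. -/
def EdgeLabelOn.restrict (h : P ⊆ Q) (x : EdgeLabelOn D Q) : EdgeLabelOn D P :=
  fun e => x ⟨e, h e.2⟩

open scoped Classical in
/-- The label that agrees with `x` on `P` and with `J₀` elsewhere. -/
noncomputable def EdgeLabel.fill (J₀ : EdgeLabel D) (x : EdgeLabelOn D P) : EdgeLabel D :=
  fun e => if h : e ∈ P then x ⟨e, h⟩ else J₀ e

theorem EdgeLabel.fill_of_mem (J₀ : EdgeLabel D) (x : EdgeLabelOn D P) {e : G.edgeSet}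
    (h : e ∈ P) : J₀.fill x e = x ⟨e, h⟩ :=
  dif_pos h

theorem EdgeLabel.fill_of_notMem (J₀ : EdgeLabel D) (x : EdgeLabelOn D P) {e : G.edgeSet}
    (h : e ∉ P) : J₀.fill x e = J₀ e :=
  dif_neg h

theorem EdgeLabel.fill_domRestrict_of_mem (J₀ J : EdgeLabel D) {e : G.edgeSet} (h : e ∈ P) :
    J₀.fill (P.domRestrict J) e = J e :=
  J₀.fill_of_mem _ h

theorem EdgeLabel.fill_fill_domRestrict_of_mem (J₀ J : EdgeLabel D) {e : G.edgeSet}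
    (h : e ∈ P ∪ Q) : (J₀.fill (Q.domRestrict J)).fill (P.domRestrict J) e = J e := by
  by_cases hP : e ∈ P
  · rw [fill_domRestrict_of_mem _ _ hP]
  · rw [fill_of_notMem _ _ hP, fill_domRestrict_of_mem _ _ (h.resolve_left hP)]

open scoped Classical in
/-- A label of all edges as its parts on `N`, on the edges outside `N ∪ O`, and on `O`. -/
noncomputable def EdgeLabel.splitEquiv (D : G.edgeSet → ℕ) (hNO : Disjoint N O) :
    EdgeLabel D ≃ EdgeLabelOn D N × EdgeLabelOn D (N ∪ O)ᶜ × EdgeLabelOn D O where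
  toFun J := (N.domRestrict J, (N ∪ O)ᶜ.domRestrict J, O.domRestrict J)
  invFun y e :=
    if hN : e ∈ N then y.1 ⟨e, hN⟩
    else if hO : e ∈ O then y.2.2 ⟨e, hO⟩
    else y.2.1 ⟨e, fun h => h.elim hN hO⟩
  left_inv J := by
    funext e
    by_cases hN : e ∈ N <;> by_cases hO : e ∈ O <;> simp [hN, hO]
  right_inv y := by
    refine Prod.ext (funext fun e => dif_pos e.2)
      (Prod.ext (funext fun e => ?_) (funext fun e => ?_))
    · have he := not_or.1 e.2
      exact (dif_neg he.1).trans (dif_neg he.2)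
    · exact (dif_neg (Set.disjoint_right.1 hNO e.2)).trans (dif_pos e.2)

end EdgeLabels

section SplitSums

variable {L N Ω O S T m n : Type*} [Fintype L] [Fintype N] [Fintype Ω] [Fintype O]

theorem sum_split (E : L ≃ N × Ω × O) (π : Ω → S) (lam : N → S → ℝ) (w : Ω → O → ℝ) :
    ∑ J, lam (E J).1 (π (E J).2.1) * w (E J).2.1 (E J).2.2 =
      ∑ x, (∑ n, lam n (π x)) * ∑ o, w x o := by
  rw [E.sum_comp fun y => lam y.1 (π y.2.1) * w y.2.1 y.2.2, Fintype.sum_prod_type]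
  simp only [Fintype.sum_prod_type, Finset.sum_mul_sum]
  exact Finset.sum_comm

theorem sum_pureState_split [Fintype T] [DecidableEq T] [DecidableEq (T × O)] (E : L ≃ N × Ω × O)
    (π : Ω → S) (κ : Ω → T) {lam : N → S → ℝ} (hlam : ∀ n s, 0 ≤ lam n s) (w : Ω → O → ℝ)
    (ξ : Ω → m → ℂ) (v : N × S → n → ℂ) :
    ∑ y : T × O, pureState (∑ J with (κ (E J).2.1, (E J).2.2) = y,
      ((√(lam (E J).1 (π (E J).2.1) * w (E J).2.1 (E J).2.2) : ℝ) : ℂ) •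
        tensorVec (ξ (E J).2.1) (v ((E J).1, π (E J).2.1))) =
    labelState κ w ξ fun x => ∑ n, ((√(lam n (π x)) : ℝ) : ℂ) • v (n, π x) := by
  classical
  rw [Fintype.sum_prod_type, labelState]
  refine Finset.sum_congr rfl fun y _ => Finset.sum_congr rfl fun o _ => congrArg pureState ?_
  simp only [Finset.sum_filter]
  rw [E.sum_comp fun z => if (κ z.2.1, z.2.2) = (y, o) then
    ((√(lam z.1 (π z.2.1) * w z.2.1 z.2.2) : ℝ) : ℂ) • tensorVec (ξ z.2.1) (v (z.1, π z.2.1))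
    else 0]
  simp only [Fintype.sum_prod_type, Prod.mk.injEq, ite_and]
  rw [Finset.sum_comm]
  refine Finset.sum_congr rfl fun x _ => ?_
  split_ifs with hx
  · simp only [Finset.sum_ite_eq', Finset.mem_univ, if_true, tensorVec_sum, tensorVec_smul,
      Finset.smul_sum, smul_smul, Real.sqrt_mul (hlam _ _), Complex.ofReal_mul,
      mul_comm ((√(w x o) : ℝ) : ℂ)]
  · simp

end SplitSums

section EdgeFilter

variable {V : Type*} [Fintype V] {G : SimpleGraph V} {D : G.edgeSet → ℕ} {B : LocalFamily D}
  {X U : Set (HalfEdge G)} {N O P S : Set G.edgeSet}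

theorem LocalFamily.IsOrthonormal.isOrthogonal_vec_fill_fiber (hB : B.IsOrthonormal)
    (J₀ : EdgeLabel D) {M : Set G.edgeSet} (hPM : P ⊆ M) (hM : M ⊆ P ∪ HalfEdge.edge '' X)
    (a : EdgeLabelOn D P) :
    IsOrthogonal (fun x : {x : EdgeLabelOn D M // x.restrict hPM = a} =>
      B.vec X (J₀.fill x.1)) 1 := by
  refine hB.isOrthogonal_vec fun x y hxy => Subtype.ext (funext fun e => ?_)
  rcases hM e.2 with he | he
  · exact congrFun (x.2.trans y.2.symm) ⟨e, he⟩
  · have := hxy e he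
    rwa [EdgeLabel.fill_of_mem _ _ e.2, EdgeLabel.fill_of_mem _ _ e.2] at this

theorem LocalFamily.IsOrthonormal.isOrthogonal_vec_fill_fill (hB : B.IsOrthonormal)
    (J₀ : EdgeLabel D) (hNS : Disjoint N S) (hU : N ∪ S ⊆ HalfEdge.edge '' U) :
    IsOrthogonal (fun y : EdgeLabelOn D N × EdgeLabelOn D S => B.vec U ((J₀.fill y.2).fill y.1))
      1 := by
  refine hB.isOrthogonal_vec fun y z hyz => Prod.ext (funext fun e => ?_) (funext fun e => ?_)
  · have := hyz e (hU (Or.inl e.2))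
    rwa [EdgeLabel.fill_of_mem _ _ e.2, EdgeLabel.fill_of_mem _ _ e.2] at this
  · have he := Set.disjoint_right.1 hNS e.2
    have := hyz e (hU (Or.inr e.2))
    rwa [EdgeLabel.fill_of_notMem _ _ he, EdgeLabel.fill_of_notMem _ _ he,
      EdgeLabel.fill_of_mem _ _ e.2, EdgeLabel.fill_of_mem _ _ e.2] at this

open scoped Classical in
theorem LocalFamily.IsOrthonormal.reducedState_eq_labelState (hB : B.IsOrthonormal)
    (J₀ : EdgeLabel D) (hXU : Disjoint X U) (hNO : Disjoint N O) (hS : S ⊆ (N ∪ O)ᶜ)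
    (hP : P ⊆ (N ∪ O)ᶜ) (hX : HalfEdge.edge '' X ⊆ (N ∪ O)ᶜ) (hU : HalfEdge.edge '' U ⊆ N ∪ S)
    (hXUc : HalfEdge.edge '' (X ∪ U)ᶜ = P ∪ O) {lam : EdgeLabelOn D N → EdgeLabelOn D S → ℝ}
    (hlam : ∀ n s, 0 ≤ lam n s) (w : EdgeLabelOn D (N ∪ O)ᶜ → EdgeLabelOn D O → ℝ)
    {μ : EdgeLabel D → ℝ} (hμ : ∀ J, μ J = lam (N.domRestrict J) (S.domRestrict J) *
      w ((N ∪ O)ᶜ.domRestrict J) (O.domRestrict J)) :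
    reducedState X U (pureState (∑ J, ((√(μ J) : ℝ) : ℂ) • B.fullVec J)) =
      labelState (EdgeLabelOn.restrict hP) w (fun x => B.vec X (J₀.fill x)) fun x =>
        ∑ n, ((√(lam n (x.restrict hS)) : ℝ) : ℂ) •
          B.vec U ((J₀.fill (x.restrict hS)).fill n) := by
  have henv (J J' : EdgeLabel D) :
      (P.domRestrict J, O.domRestrict J) = (P.domRestrict J', O.domRestrict J') ↔
        ∀ e ∈ HalfEdge.edge '' (X ∪ U)ᶜ, J e = J' e := by
    rw [hXUc, Prod.mk.injEq, funext_iff, funext_iff]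
    simp only [Subtype.forall, Set.domRestrict_apply, Set.mem_union, or_imp, forall_and]
  rw [hB.reducedState_pureState_sum hXU (fun J => (P.domRestrict J, O.domRestrict J)) henv,
    ← sum_pureState_split (EdgeLabel.splitEquiv D hNO) (EdgeLabelOn.restrict hS) _ hlam w _ fun y =>
      B.vec U ((J₀.fill y.2).fill y.1)]
  refine Finset.sum_congr rfl fun y _ => congrArg pureState
    (Finset.sum_congr rfl fun J _ => ?_)
  rw [hμ]
  congr 2
  · exact B.vec_congr fun e he => (J₀.fill_domRestrict_of_mem J (hX he)).symm
  · exact B.vec_congr fun e he => (J₀.fill_fill_domRestrict_of_mem J (hU he)).symm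

open scoped Classical in
theorem LocalFamily.IsOrthonormal.exists_filter_of_split (hB : B.IsOrthonormal)
    (J₀ : EdgeLabel D) {W : Set (HalfEdge G)} {K T : Set G.edgeSet} (hXU : Disjoint X U)
    (hXW : Disjoint X W) (hNO : Disjoint N O) (hNS : Disjoint N S) (hS : S ⊆ (N ∪ O)ᶜ)
    (hT : T ⊆ (N ∪ O)ᶜ) (hKT : K ⊆ T) (hX : HalfEdge.edge '' X ⊆ (N ∪ O)ᶜ)
    (hXS : (N ∪ O)ᶜ ⊆ S ∪ HalfEdge.edge '' X) (hXT : (N ∪ O)ᶜ ⊆ T ∪ HalfEdge.edge '' X)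
    (hU : HalfEdge.edge '' U = N ∪ S) (hW : HalfEdge.edge '' W = N ∪ S)
    (hXUc : HalfEdge.edge '' (X ∪ U)ᶜ = T ∪ O) (hXWc : HalfEdge.edge '' (X ∪ W)ᶜ = K ∪ O)
    {lam : EdgeLabelOn D N → EdgeLabelOn D S → ℝ} {χ : EdgeLabelOn D (N ∪ O)ᶜ → ℝ}
    {q : EdgeLabelOn D K → EdgeLabelOn D O → ℝ} (hlam : ∀ n s, 0 ≤ lam n s)
    (hχ : ∀ x, 0 ≤ χ x) (hq : ∀ k o, 0 ≤ q k o) {μ : EdgeLabel D → ℝ}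
    (hμ : ∀ J, μ J = lam (N.domRestrict J) (S.domRestrict J) *
      (χ ((N ∪ O)ᶜ.domRestrict J) * q (K.domRestrict J) (O.domRestrict J)))
    (h_sum : ∑ J, μ J ≤ 1) {ε : ℝ} (hε : 0 ≤ ε) :
    ∃ f : EdgeLabelOn D (N ∪ O)ᶜ → ℝ, (∀ x, 0 ≤ f x) ∧ (∀ x, f x ≤ 1) ∧
      ∑ J, μ J * (1 - f ((N ∪ O)ᶜ.domRestrict J)) ≤ ε ∧
      ∀ g : EdgeLabelOn D (N ∪ O)ᶜ → EdgeLabelOn D O → ℝ, (∀ x o, 0 ≤ g x o) →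
        (∀ x o, g x o ≤ f x) →
        smoothCondMinEntropy ε
            (reducedState X W (pureState (∑ J, ((√(μ J) : ℝ) : ℂ) • B.fullVec J))) ≤
          condMinEntropy (reducedState X U (pureState (∑ J,
            ((√(μ J * g ((N ∪ O)ᶜ.domRestrict J) (O.domRestrict J)) : ℝ) : ℂ) •
              B.fullVec J))) := by
  have hα := (hB.isOrthogonal_vec_fill_fill J₀ hNS hU.ge).superposition hlam
  have hβ := (hB.isOrthogonal_vec_fill_fill J₀ hNS hW.ge).superposition hlam
  have h_split (h : EdgeLabelOn D (N ∪ O)ᶜ → ℝ) :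
      ∑ J, μ J * h ((N ∪ O)ᶜ.domRestrict J) =
        ∑ x, (∑ n, lam n (x.restrict hS)) * χ x *
          (∑ o, q ((x.restrict hT).restrict hKT) o) * h x := by
    calc
      _ = ∑ J : EdgeLabel D, lam (N.domRestrict J) (S.domRestrict J) *
          (χ ((N ∪ O)ᶜ.domRestrict J) * q (K.domRestrict J) (O.domRestrict J) *
            h ((N ∪ O)ᶜ.domRestrict J)) := by simp only [hμ, mul_assoc]
      _ = _ := sum_split (EdgeLabel.splitEquiv D hNO) (EdgeLabelOn.restrict hS) lam
          fun x o => χ x * q ((x.restrict hT).restrict hKT) o * h x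
      _ = ∑ x, (∑ n, lam n (x.restrict hS)) * χ x *
          (∑ o, q ((x.restrict hT).restrict hKT) o) * h x := by
        simp only [← Finset.sum_mul, ← Finset.mul_sum, mul_assoc]
  have h_sum' : ∑ x : EdgeLabelOn D (N ∪ O)ᶜ, (∑ n, lam n (x.restrict hS)) * χ x *
      ∑ o, q ((x.restrict hT).restrict hKT) o ≤ 1 := by
    have := h_split fun _ => 1
    simp only [mul_one] at this
    exact this.symm.trans_le h_sum
  obtain ⟨f, hf_nonneg, hf_le_one, hloss, hf⟩ := exists_filter_smoothCondMinEntropy_labelState_le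
    (π := EdgeLabelOn.restrict hS) (κ := EdgeLabelOn.restrict hT) (c := EdgeLabelOn.restrict hKT)
    (ξ := fun x => B.vec X (J₀.fill x)) (Λ := fun s => ∑ n, lam n s)
    (hB.isOrthogonal_vec_fill_fiber J₀ hS hXS) (hB.isOrthogonal_vec_fill_fiber J₀ hT hXT) hα hβ
    hχ hq h_sum' hε
  refine ⟨f, hf_nonneg, hf_le_one, (h_split fun x => 1 - f x).trans_le hloss, fun g hg hgf => ?_⟩
  rw [hB.reducedState_eq_labelState J₀ hXW hNO hS (hKT.trans hT) hX hW.le hXWc hlam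
    (fun x o => χ x * q ((x.restrict hT).restrict hKT) o) hμ,
    hB.reducedState_eq_labelState J₀ hXU hNO hS hT hX hU.le hXUc hlam
    (fun x o => χ x * q ((x.restrict hT).restrict hKT) o * g x o) fun J => by
      rw [hμ, mul_assoc]; rfl]
  exact hf g hg hgf

omit [Fintype V] in
theorem HalfEdge.mem_image_edge_union_compl (X U : Set (HalfEdge G)) (e : G.edgeSet) :
    e ∈ HalfEdge.edge '' X ∨ e ∈ HalfEdge.edge '' U ∨ e ∈ HalfEdge.edge '' (X ∪ U)ᶜ := by
  rw [← or_assoc, ← Set.mem_union, ← Set.image_union, ← Set.mem_union, ← Set.image_union,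
    Set.union_compl_self]
  exact ⟨⟨e, e.1.out.1, Sym2.out_fst_mem e.1⟩, trivial, rfl⟩

omit [Fintype V] in
theorem HalfEdge.image_edge_compl_of_disjoint (hXU : Disjoint X U) :
    HalfEdge.edge '' Uᶜ = HalfEdge.edge '' X ∪ HalfEdge.edge '' (X ∪ U)ᶜ := by
  rw [← Set.image_union]
  congr 1
  grind [Set.disjoint_left.1 hXU]

omit [Fintype V] in
theorem reducedState_pureState_zero [Finite V] :
    reducedState X U (pureState (0 : FullConfig D → ℂ)) = 0 := by
  ext
  simp [reducedState, pureState]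

open scoped Classical in
/-- A filter on the edge labels of `∑ √μ_J |B_J⟩` that loses weight at most `ε` and ensures
`H_min(X|U) ≥ H_min^ε(X|W)`, the left side being that of the filtered state. To be preserved by
further filtering, the bound is asked of all smaller filters; like `F` itself, these may depend only
on the edges that leave `U` or avoid it. -/
structure LocalFamily.IsSmoothingFilter (B : LocalFamily D) (X U W : Set (HalfEdge G))
    (μ : EdgeLabel D → ℝ) (ε : ℝ) (F : EdgeLabel D → ℝ) : Prop where
  nonneg : ∀ J, 0 ≤ F J
  le_one : ∀ J, F J ≤ 1
  sum_le : ∑ J, μ J * (1 - F J) ≤ ε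
  dependsOn : DependsOn F (HalfEdge.edge '' Uᶜ)
  smoothCondMinEntropy_le : ∀ g : EdgeLabel D → ℝ, DependsOn g (HalfEdge.edge '' Uᶜ) →
    (∀ J, 0 ≤ g J) → (∀ J, g J ≤ F J) →
      smoothCondMinEntropy ε
          (reducedState X W (pureState (∑ J, ((√(μ J) : ℝ) : ℂ) • B.fullVec J))) ≤
        condMinEntropy
          (reducedState X U (pureState (∑ J, ((√(μ J * g J) : ℝ) : ℂ) • B.fullVec J)))

open scoped Classical in
theorem LocalFamily.IsOrthonormal.exists_isSmoothingFilter (hB : B.IsOrthonormal)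
    {W : Set (HalfEdge G)} (hXU : Disjoint X U) (hXW : Disjoint X W)
    (hW : HalfEdge.edge '' W = HalfEdge.edge '' U)
    (hXWc : HalfEdge.edge '' (X ∪ W)ᶜ = HalfEdge.edge '' (X ∪ U)ᶜ \ HalfEdge.edge '' U)
    {M₁ M₂ M₃ : EdgeLabel D → ℝ} (hM₁ : ∀ J, 0 ≤ M₁ J) (hM₂ : ∀ J, 0 ≤ M₂ J)
    (hM₃ : ∀ J, 0 ≤ M₃ J) (hM₁U : DependsOn M₁ (HalfEdge.edge '' U))
    (hM₂X : DependsOn M₂ (HalfEdge.edge '' X)) (hM₃W : DependsOn M₃ (HalfEdge.edge '' (X ∪ W)ᶜ))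
    {μ : EdgeLabel D → ℝ} (hμ : ∀ J, μ J = M₁ J * (M₂ J * M₃ J)) (h_sum : ∑ J, μ J ≤ 1) {ε : ℝ}
    (hε : 0 ≤ ε) : ∃ F, B.IsSmoothingFilter X U W μ ε F := by
  rcases isEmpty_or_nonempty (EdgeLabel D) with _ | ⟨⟨J₀⟩⟩
  · exact ⟨0, isEmptyElim, isEmptyElim, by simpa using hε, fun J => isEmptyElim J,
      fun g _ _ _ => by simp [reducedState_pureState_zero, condMinEntropy_zero]⟩
  have hUc := HalfEdge.image_edge_compl_of_disjoint hXU
  have h_cover := HalfEdge.mem_image_edge_union_compl X U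
  generalize ht : HalfEdge.edge '' (X ∪ U)ᶜ = t at *
  generalize HalfEdge.edge '' Uᶜ = u at *
  generalize hr : HalfEdge.edge '' X = r at *
  generalize ha : HalfEdge.edge '' U = a at *
  subst hUc
  -- `N` and `O` collect the edges both ends of which lie in `U`, respectively outside `X ∪ U`.
  obtain ⟨f, hf_nonneg, hf_le_one, hloss, hf⟩ := hB.exists_filter_of_split J₀ hXU hXW
    (N := (r ∪ t)ᶜ) (O := (r ∪ a)ᶜ) (S := ((r ∪ t)ᶜ ∪ (r ∪ a)ᶜ)ᶜ ∩ a)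
    (T := ((r ∪ t)ᶜ ∪ (r ∪ a)ᶜ)ᶜ ∩ t) (K := (((r ∪ t)ᶜ ∪ (r ∪ a)ᶜ)ᶜ ∩ t) \ a)
    (Set.disjoint_left.2 fun e => by grind) (Set.disjoint_left.2 fun e => by grind)
    Set.inter_subset_left Set.inter_subset_left Set.sdiff_subset (by grind) (by grind) (by grind)
    (ha.trans (Set.ext fun e => by grind)) (hW.trans (Set.ext fun e => by grind))
    (ht.trans (Set.ext fun e => by grind)) (hXWc.trans (Set.ext fun e => by grind))
    (lam := fun n s => M₁ ((J₀.fill s).fill n)) (χ := fun x => M₂ (J₀.fill x))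
    (q := fun k o => M₃ ((J₀.fill o).fill k)) (fun n s => hM₁ _) (fun x => hM₂ _) (fun k o => hM₃ _)
    (fun J => (hμ J).trans <| congrArg₂ _
      (hM₁U fun e he => (J₀.fill_fill_domRestrict_of_mem J (by grind)).symm)
      (congrArg₂ _ (hM₂X fun e he => (J₀.fill_domRestrict_of_mem J (by grind)).symm)
        (hM₃W fun e he => (J₀.fill_fill_domRestrict_of_mem J (by grind)).symm)))
    h_sum hε
  refine ⟨fun J => f (((r ∪ t)ᶜ ∪ (r ∪ a)ᶜ)ᶜ.domRestrict J), fun J => hf_nonneg _,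
    fun J => hf_le_one _, hloss, fun J J' h => congrArg f (funext fun e => h _ (by grind)),
    fun g hg hg_nonneg hgf => ?_⟩
  have hg_fill (J : EdgeLabel D) : g J = g ((J₀.fill ((r ∪ a)ᶜ.domRestrict J)).fill
      (((r ∪ t)ᶜ ∪ (r ∪ a)ᶜ)ᶜ.domRestrict J)) :=
    hg fun e he => (J₀.fill_fill_domRestrict_of_mem J (by grind)).symm
  simp_rw +singlePass [hg_fill]
  exact hf (fun x o => g ((J₀.fill o).fill x)) (fun x o => hg_nonneg _) fun x o =>
    (hgf _).trans_eq (congrArg f (funext fun e => EdgeLabel.fill_of_mem _ x e.2))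

end EdgeFilter

section CutFilter

variable {V : Type*} {G : SimpleGraph V} {A Δ : Set V}

theorem image_edge_halfEdgesAt (G : SimpleGraph V) (S : Set V) :
    HalfEdge.edge '' halfEdgesAt G S = incidentEdges G S :=
  Set.ext fun e => ⟨fun ⟨h, hS, he⟩ => ⟨h.vertex, hS, he ▸ h.mem⟩,
    fun ⟨x, hx, hxe⟩ => ⟨⟨e, x, hxe⟩, hx, rfl⟩⟩

theorem disjoint_halfEdgesAt_diff (G : SimpleGraph V) (A Δ : Set V) :
    Disjoint (halfEdgesAt G (Δ \ A)) (halfEdgesAt G A) :=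
  Set.disjoint_left.2 fun _ hΔ hA => hΔ.2 hA

theorem disjoint_halfEdgesAt_diff_union_outerHalfEdges (G : SimpleGraph V) (A Δ : Set V) :
    Disjoint (halfEdgesAt G (Δ \ A)) (halfEdgesAt G A ∪ outerHalfEdges G A Δ) :=
  Set.disjoint_union_right.2
    ⟨disjoint_halfEdgesAt_diff G A Δ, Set.disjoint_left.2 fun _ hΔ hY => hY.1 hΔ.1⟩

theorem compl_halfEdgesAt_diff_union (hAΔ : A ⊆ Δ) :
    (halfEdgesAt G (Δ \ A) ∪ halfEdgesAt G A)ᶜ = halfEdgesAt G Δᶜ := by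
  refine congrArg Compl.compl (Set.ext fun h => ?_)
  exact Set.ext_iff.1 (Set.sdiff_union_of_subset hAΔ) h.vertex

theorem image_edge_halfEdgesAt_union_outerHalfEdges (G : SimpleGraph V) (A Δ : Set V) :
    HalfEdge.edge '' (halfEdgesAt G A ∪ outerHalfEdges G A Δ) =
      HalfEdge.edge '' halfEdgesAt G A := by
  refine (Set.image_union _ _ _).trans (Set.union_eq_left.2 ?_)
  rintro _ ⟨h, ⟨_, y, hy, hye⟩, rfl⟩
  exact ⟨⟨h.edge, y, hye ▸ Sym2.mem_mk_right _ _⟩, hy, rfl⟩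

theorem image_edge_compl_halfEdgesAt_diff_union (hAΔ : A ⊆ Δ) :
    HalfEdge.edge '' (halfEdgesAt G (Δ \ A) ∪ halfEdgesAt G A)ᶜ = incidentEdges G Δᶜ := by
  rw [compl_halfEdgesAt_diff_union hAΔ, image_edge_halfEdgesAt]

theorem image_edge_compl_union_outerHalfEdges (hAΔ : A ⊆ Δ) :
    HalfEdge.edge '' (halfEdgesAt G (Δ \ A) ∪ (halfEdgesAt G A ∪ outerHalfEdges G A Δ))ᶜ =
      incidentEdges G Δᶜ \ incidentEdges G A := by
  rw [← Set.union_assoc, Set.compl_union, compl_halfEdgesAt_diff_union hAΔ,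
    ← image_edge_halfEdgesAt, ← image_edge_halfEdgesAt]
  ext e
  constructor
  · rintro ⟨h, ⟨hΔ, hY⟩, rfl⟩
    refine ⟨⟨h, hΔ, rfl⟩, ?_⟩
    rintro ⟨h', hA, he⟩
    have hne : h.vertex ≠ h'.vertex := fun heq => hΔ (heq ▸ hAΔ hA)
    exact hY ⟨hΔ, h'.vertex, hA, (Sym2.mem_and_mem_iff hne).1 ⟨h.mem, he ▸ h'.mem⟩⟩
  · rintro ⟨⟨h, hΔ, rfl⟩, hA⟩
    exact ⟨h, ⟨hΔ, fun ⟨_, y, hy, hye⟩ => hA ⟨⟨h.edge, y, hye ▸ Sym2.mem_mk_right _ _⟩, hy, rfl⟩⟩,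
      rfl⟩

theorem mem_incidentEdges_diff {e : G.edgeSet} (hA : e ∉ incidentEdges G A)
    (hΔ : e ∉ incidentEdges G Δᶜ) : e ∈ incidentEdges G (Δ \ A) :=
  ⟨e.1.out.1, ⟨by_contra fun hx => hΔ ⟨_, hx, Sym2.out_fst_mem e.1⟩,
    fun hx => hA ⟨_, hx, Sym2.out_fst_mem e.1⟩⟩, Sym2.out_fst_mem e.1⟩

theorem incidentEdges_bdry_diff_subset {bdry : Set V} (hΔ : Δ ∈ cuts bdry A) :
    incidentEdges G (bdry \ A) ⊆ incidentEdges G Δᶜ := fun _ ⟨x, hx, hxe⟩ =>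
  ⟨x, fun hxΔ => hx.2 (hΔ.le ⟨hxΔ, hx.1⟩), hxe⟩

variable [Fintype V] {D : G.edgeSet → ℕ} {γ₁ γ₂ : Set G.edgeSet} {lam₁ : EdgeLabelOn D γ₁ → ℝ}
  {lam₂ : EdgeLabelOn D γ₂ → ℝ} {ν : (e : G.edgeSet) → Fin (D e) → ℝ}

open scoped Classical in
/-- The squared Schmidt coefficient of the label `J` of a background vector, `lam₁`, `lam₂` and
`ν e` being those of its factors on `γ₁`, `γ₂` and on the further edges `e`. -/
noncomputable def schmidtWeight (lam₁ : EdgeLabelOn D γ₁ → ℝ) (lam₂ : EdgeLabelOn D γ₂ → ℝ)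
    (ν : (e : G.edgeSet) → Fin (D e) → ℝ) (J : EdgeLabel D) : ℝ :=
  lam₁ (γ₁.domRestrict J) * lam₂ (γ₂.domRestrict J) *
    ∏ e : ((γ₁ ∪ γ₂)ᶜ : Set G.edgeSet), ν e.1 (J e)

theorem schmidtWeight_nonneg (h₁ : ∀ I, 0 ≤ lam₁ I) (h₂ : ∀ I, 0 ≤ lam₂ I)
    (hν : ∀ e l, 0 ≤ ν e l) (J : EdgeLabel D) : 0 ≤ schmidtWeight lam₁ lam₂ ν J :=
  mul_nonneg (mul_nonneg (h₁ _) (h₂ _)) (Finset.prod_nonneg fun _ _ => hν _ _)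

open scoped Classical in
theorem LocalFamily.IsOrthonormal.exists_isSmoothingFilter_of_mem_cuts {B : LocalFamily D}
    (hB : B.IsOrthonormal) {bdry : Set V}
    (hdisj : Disjoint (incidentEdges G A) (incidentEdges G (bdry \ A))) (hΔ : Δ ∈ cuts bdry A)
    {lam₁ : EdgeLabelOn D (incidentEdges G A) → ℝ}
    {lam₂ : EdgeLabelOn D (incidentEdges G (bdry \ A)) → ℝ} (h₁ : ∀ I, 0 ≤ lam₁ I)
    (h₂ : ∀ I, 0 ≤ lam₂ I) (hν : ∀ e l, 0 ≤ ν e l)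
    (h_sum : ∑ J, schmidtWeight lam₁ lam₂ ν J ≤ 1) {ε : ℝ} (hε : 0 ≤ ε) :
    ∃ F, B.IsSmoothingFilter (halfEdgesAt G (Δ \ A)) (halfEdgesAt G A)
      (halfEdgesAt G A ∪ outerHalfEdges G A Δ) (schmidtWeight lam₁ lam₂ ν) ε F := by
  have hAΔ : A ⊆ Δ := fun x hx => (hΔ.ge hx).1
  refine hB.exists_isSmoothingFilter (disjoint_halfEdgesAt_diff G A Δ)
    (disjoint_halfEdgesAt_diff_union_outerHalfEdges G A Δ)
    (image_edge_halfEdgesAt_union_outerHalfEdges G A Δ)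
    (by rw [image_edge_compl_union_outerHalfEdges hAΔ,
      image_edge_compl_halfEdgesAt_diff_union hAΔ, image_edge_halfEdgesAt])
    (M₁ := fun J => lam₁ ((incidentEdges G A).domRestrict J))
    (M₂ := fun J => ∏ e : ((incidentEdges G A ∪ incidentEdges G (bdry \ A))ᶜ : Set G.edgeSet) with
      e.1 ∉ incidentEdges G Δᶜ, ν e.1 (J e))
    (M₃ := fun J => lam₂ ((incidentEdges G (bdry \ A)).domRestrict J) *
      ∏ e : ((incidentEdges G A ∪ incidentEdges G (bdry \ A))ᶜ : Set G.edgeSet) with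
        e.1 ∈ incidentEdges G Δᶜ, ν e.1 (J e))
    (fun J => h₁ _) (fun J => Finset.prod_nonneg fun e _ => hν _ _)
    (fun J => mul_nonneg (h₂ _) (Finset.prod_nonneg fun e _ => hν _ _))
    ?_ ?_ ?_ (fun J => ?_) h_sum hε
  · rw [image_edge_halfEdgesAt]
    exact fun J J' h => congrArg lam₁ (funext fun e => h _ e.2)
  · rw [image_edge_halfEdgesAt]
    exact fun J J' h => Finset.prod_congr rfl fun e he => congrArg (ν e.1) <| h _ <|
      mem_incidentEdges_diff (fun hA => e.2 (Or.inl hA)) (Finset.mem_filter.1 he).2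
  · rw [image_edge_compl_union_outerHalfEdges hAΔ]
    refine fun J J' h => congrArg₂ _ (congrArg lam₂ (funext fun e => h _ ?_))
      (Finset.prod_congr rfl fun e he => congrArg (ν e.1) (h _ ?_))
    · exact ⟨incidentEdges_bdry_diff_subset hΔ e.2, Set.disjoint_right.1 hdisj e.2⟩
    · exact ⟨(Finset.mem_filter.1 he).2, fun hA => e.2 (Or.inl hA)⟩
  · rw [schmidtWeight, ← Finset.prod_filter_mul_prod_filter_not _
      (fun e : ((incidentEdges G A ∪ incidentEdges G (bdry \ A))ᶜ : Set G.edgeSet) =>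
        e.1 ∈ incidentEdges G Δᶜ)]
    ring

end CutFilter

section SingularValueDecomposition

variable {n ι : Type*} [Fintype n]

theorem isOrthogonal_ofLp_iff_orthonormal {v : ι → EuclideanSpace ℂ n} :
    IsOrthogonal (fun i => (v i).ofLp) 1 ↔ Orthonormal ℂ v := by
  classical
  have hinner (x y : EuclideanSpace ℂ n) : inner ℂ x y = star x.ofLp ⬝ᵥ y.ofLp := by
    rw [EuclideanSpace.inner_eq_star_dotProduct, dotProduct_comm]
  rw [orthonormal_iff_ite]
  refine ⟨fun h i j => ?_, fun h => .of_dotProduct_eq fun i j => ?_⟩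
  · rw [hinner, h.dotProduct_eq, Pi.one_apply, Complex.ofReal_one]
  · rw [← hinner, h, Pi.one_apply, Complex.ofReal_one]

namespace IsOrthogonal

protected theorem star {v : ι → n → ℂ} {c : ι → ℝ} (h : IsOrthogonal v c) :
    IsOrthogonal (fun i => star (v i)) c :=
  ⟨fun i => by rw [star_star, dotProduct_comm, h.normSq],
    fun i j hij => by
      dsimp only
      rw [star_star, dotProduct_comm, h.orthogonal hij.symm]⟩

theorem sum_pureState_eq_one [DecidableEq n] {v : n → n → ℂ} (h : IsOrthogonal v 1) :
    ∑ i, pureState (v i) = 1 := by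
  have hgram : (Matrix.of v)ᵀᴴ * (Matrix.of v)ᵀ = 1 := by
    ext i j
    rw [Matrix.one_apply]
    exact (h.dotProduct_eq i j).trans (by rw [Pi.one_apply, Complex.ofReal_one])
  rw [← mul_eq_one_comm.1 hgram]
  ext p q
  simp [pureState, Matrix.sum_apply, vecMulVec_apply, Matrix.mul_apply]

theorem exists_eq_sqrt_smul {v : n → n → ℂ} {c : n → ℝ} (h : IsOrthogonal v c) :
    ∃ u : n → n → ℂ, IsOrthogonal u 1 ∧ ∀ i, v i = ((√(c i) : ℝ) : ℂ) • u i := by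
  have hnormalize : IsOrthogonal (fun i : {i | c i ≠ 0} => normalize v c i) 1 := by
    have := h.normalize_isOrthogonal.comp (Subtype.val_injective (p := (· ∈ {i | c i ≠ 0})))
    rwa [show (fun i => (c i)⁻¹ * c i) ∘ Subtype.val = 1 from
      funext fun i => inv_mul_cancel₀ i.2] at this
  obtain ⟨u, hu⟩ := Orthonormal.exists_orthonormalBasis_extension_of_card_eq (𝕜 := ℂ)
    (v := fun i => WithLp.toLp 2 (normalize v c i)) (s := {i | c i ≠ 0}) (by simp)
    (isOrthogonal_ofLp_iff_orthonormal.1 hnormalize)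
  refine ⟨fun i => (u i).ofLp, isOrthogonal_ofLp_iff_orthonormal.2 u.orthonormal, fun i => ?_⟩
  by_cases hi : c i = 0
  · rw [h.eq_zero_of_normSq_eq_zero hi, hi, Real.sqrt_zero, Complex.ofReal_zero, zero_smul]
  · simp only [hu i hi, h.sqrt_smul_normalize]

end IsOrthogonal

theorem exists_eq_sum_sqrt_smul_vecMulVec (M : Matrix n n ℂ) :
    ∃ (ν : n → ℝ) (U W : n → n → ℂ), (∀ l, 0 ≤ ν l) ∧ IsOrthogonal U 1 ∧ IsOrthogonal W 1 ∧
      M = ∑ l, ((√(ν l) : ℝ) : ℂ) • vecMulVec (U l) (W l) := by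
  classical
  have hH : (Mᴴ * M).IsHermitian := isHermitian_conjTranspose_mul_self M
  set ν := hH.eigenvalues
  set b := hH.eigenvectorBasis
  have hb : IsOrthogonal (fun l => (b l).ofLp) 1 :=
    isOrthogonal_ofLp_iff_orthonormal.2 b.orthonormal
  have himage : IsOrthogonal (fun l => M *ᵥ (b l).ofLp) ν := .of_dotProduct_eq fun l l' => by
    rw [← dotProduct_conjTranspose_mul_self_mulVec, hH.mulVec_eigenvectorBasis l',
      dotProduct_smul, hb.dotProduct_eq]
    split_ifs with hl
    · simp [hl, ν]
    · rw [smul_zero]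
  obtain ⟨U, hU, hMU⟩ := himage.exists_eq_sqrt_smul
  refine ⟨ν, U, fun l => star (b l).ofLp, himage.nonneg, hU, hb.star, ?_⟩
  conv_lhs => rw [← mul_one M, ← hb.sum_pureState_eq_one, Finset.mul_sum]
  exact Finset.sum_congr rfl fun l _ => by
    rw [pureState, mul_vecMulVec, hMU, smul_vecMulVec]

end SingularValueDecomposition

section BackgroundVector

variable {V : Type*} {G : SimpleGraph V} {D : G.edgeSet → ℕ} {γ γ₁ γ₂ : Set G.edgeSet}

/-- The half-edge of `e` at one of its endpoints, chosen by `Quot.out`. -/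
noncomputable abbrev HalfEdge.first (e : G.edgeSet) : HalfEdge G :=
  ⟨e, (e : Sym2 V).out.1, Sym2.out_fst_mem _⟩

/-- The half-edge of `e` at the endpoint other than that of `HalfEdge.first e`. -/
noncomputable abbrev HalfEdge.second (e : G.edgeSet) : HalfEdge G :=
  ⟨e, (e : Sym2 V).out.2, Sym2.out_snd_mem _⟩

namespace HalfEdge

theorem vertex_second_ne_vertex_first (e : G.edgeSet) : (second e).vertex ≠ (first e).vertex := by
  have h : s((first e).vertex, (second e).vertex) ∈ G.edgeSet := by
    simpa only [first, second, Sym2.mk, Prod.mk.eta, Quot.out_eq] using e.2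
  exact (SimpleGraph.mem_edgeSet _ |>.1 h).ne'

theorem eq_first_or_eq_second (h : HalfEdge G) : h = first h.edge ∨ h = second h.edge := by
  have hmem : h.vertex ∈ s((first h.edge).vertex, (second h.edge).vertex) := by
    simpa only [first, second, Sym2.mk, Prod.mk.eta, Quot.out_eq] using h.mem
  exact (Sym2.mem_iff.1 hmem).imp (HalfEdge.ext rfl) (HalfEdge.ext rfl)

theorem forall_of_first_of_second {p : HalfEdge G → Prop} (hfirst : ∀ e, p (first e))
    (hsecond : ∀ e, p (second e)) (h : HalfEdge G) : p h :=
  h.eq_first_or_eq_second.elim (fun he => he ▸ hfirst _) fun he => he ▸ hsecond _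

open scoped Classical in
theorem prod_eq_prod_first_mul_second [Fintype V] (f : HalfEdge G → ℂ) :
    ∏ h, f h = ∏ e, f (first e) * f (second e) := by
  rw [← Finset.prod_fiberwise (s := Finset.univ) (g := HalfEdge.edge)]
  refine Finset.prod_congr rfl fun e _ => ?_
  have hne : first e ≠ second e := fun h =>
    vertex_second_ne_vertex_first e (congrArg HalfEdge.vertex h.symm)
  rw [← Finset.prod_pair hne]
  refine Finset.prod_congr (Finset.ext fun h => ?_) fun _ _ => rfl
  simp only [Finset.mem_filter, Finset.mem_univ, true_and, Finset.mem_insert,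
    Finset.mem_singleton]
  constructor
  · rintro rfl
    exact h.eq_first_or_eq_second
  · rintro (rfl | rfl) <;> rfl

end HalfEdge

/-- The component at `c` of the product of the two vectors with label `l` at the ends of `e`. -/
noncomputable def LocalFamily.edgeAmp (B : LocalFamily D) (c : FullConfig D) (e : G.edgeSet)
    (l : Fin (D e)) : ℂ :=
  B (.first e) l (c (.first e)) * B (.second e) l (c (.second e))

open scoped Classical in
theorem LocalFamily.fullVec_apply [Fintype V] (B : LocalFamily D) (J : EdgeLabel D)
    (c : FullConfig D) : B.fullVec J c = ∏ e, B.edgeAmp c e (J e) :=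
  HalfEdge.prod_eq_prod_first_mul_second fun h => B h (J h.edge) (c h)

theorem FullConfig.restrict_eq_diagConfig_iff {c : FullConfig D} {I : EdgeLabelOn D γ} :
    c.restrict (halfEdgesOf γ) = diagConfig γ I ↔
      ∀ e : γ, c (.first e.1) = I e ∧ c (.second e.1) = I e := by
  refine ⟨fun h e => ⟨congrFun h ⟨.first e.1, e.2⟩, congrFun h ⟨.second e.1, e.2⟩⟩,
    fun h => funext fun x => ?_⟩
  refine HalfEdge.forall_of_first_of_second (p := fun x => ∀ hx : x.edge ∈ γ, c x = I ⟨x.edge, hx⟩)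
    (fun e he => ?_) (fun e he => ?_) x.1 x.2
  exacts [(h ⟨e, he⟩).1, (h ⟨e, he⟩).2]

/-- The family with the standard basis at the ends of the edges in `γ`, and with `U e` and `W e`
at the two ends of any other edge `e`. -/
noncomputable def schmidtFamily (γ : Set G.edgeSet)
    (U W : (e : G.edgeSet) → Fin (D e) → Fin (D e) → ℂ) : LocalFamily D := fun h =>
  open scoped Classical in
  if h.edge ∈ γ then fun l => Pi.single l 1
  else if h.vertex = (HalfEdge.first h.edge).vertex then U h.edge else W h.edge

section SchmidtFamily

variable {U W : (e : G.edgeSet) → Fin (D e) → Fin (D e) → ℂ} {c : FullConfig D} {e : G.edgeSet}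

theorem schmidtFamily_isOrthonormal (hU : ∀ e, IsOrthogonal (U e) 1)
    (hW : ∀ e, IsOrthogonal (W e) 1) : (schmidtFamily γ U W).IsOrthonormal := fun h => by
  rw [schmidtFamily]
  split_ifs
  · exact .of_dotProduct_eq fun l l' => by
      simp [Pi.single_apply, eq_comm]
  · exact hU _
  · exact hW _

theorem schmidtFamily_edgeAmp_of_mem (he : e ∈ γ) (l : Fin (D e)) :
    (schmidtFamily γ U W).edgeAmp c e l =
      (Pi.single l 1 : Fin (D e) → ℂ) (c (.first e)) *
        (Pi.single l 1 : Fin (D e) → ℂ) (c (.second e)) := by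
  have hB (h : HalfEdge G) (hh : h.edge ∈ γ) : schmidtFamily γ U W h = fun l => Pi.single l 1 :=
    if_pos hh
  rw [LocalFamily.edgeAmp, hB (.first e) he, hB (.second e) he]

theorem schmidtFamily_edgeAmp_of_notMem (he : e ∉ γ) (l : Fin (D e)) :
    (schmidtFamily γ U W).edgeAmp c e l = U e l (c (.first e)) * W e l (c (.second e)) := by
  have hfirst : schmidtFamily γ U W (.first e) = U e := (if_neg he).trans (if_pos rfl)
  have hsecond : schmidtFamily γ U W (.second e) = W e :=
    (if_neg he).trans (if_neg (HalfEdge.vertex_second_ne_vertex_first e))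
  rw [LocalFamily.edgeAmp, hfirst, hsecond]

open scoped Classical in
theorem prod_schmidtFamily_edgeAmp [Fintype V] (hγ : γ₁ ⊆ γ) (I : EdgeLabelOn D γ₁) :
    ∏ e : γ₁, (schmidtFamily γ U W).edgeAmp c e.1 (I e) =
      (Pi.single (diagConfig γ₁ I) 1 : Config D (halfEdgesOf γ₁) → ℂ) (c.restrict _) := by
  simp only [schmidtFamily_edgeAmp_of_mem (hγ (Subtype.prop _)), Pi.single_apply,
    ite_zero_mul_ite_zero, mul_one, Finset.prod_ite_zero, Finset.prod_const_one,
    FullConfig.restrict_eq_diagConfig_iff, Finset.mem_univ, true_imp_iff]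

end SchmidtFamily

/-- A vector of the space of one edge is a matrix, of which this is the singular value
decomposition. -/
theorem exists_schmidt_edge [Finite V] (e : G.edgeSet) (w : Config D (halfEdgesOf {e}) → ℂ) :
    ∃ (ν : Fin (D e) → ℝ) (U W : Fin (D e) → Fin (D e) → ℂ), (∀ l, 0 ≤ ν l) ∧
      IsOrthogonal U 1 ∧ IsOrthogonal W 1 ∧ ∀ c : FullConfig D, w (c.restrict _) =
        ∑ l, ((√(ν l) : ℝ) : ℂ) * (U l (c (.first e)) * W l (c (.second e))) := by
  classical
  obtain ⟨ν, U, W, hν, hU, hW, hM⟩ := exists_eq_sum_sqrt_smul_vecMulVec <| Matrix.of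
    fun i j : Fin (D e) => w fun h =>
      if h.1.vertex = (HalfEdge.first e).vertex then Fin.cast (congrArg D h.2).symm i
      else Fin.cast (congrArg D h.2).symm j
  refine ⟨ν, U, W, hν, hU, hW, fun c => ?_⟩
  have hentry (i j : Fin (D e)) := congrFun₂ hM i j
  simp only [of_apply, Matrix.sum_apply, Matrix.smul_apply, vecMulVec_apply, smul_eq_mul]
    at hentry
  refine Eq.trans (congrArg w (funext fun x => ?_)) (hentry (c (.first e)) (c (.second e)))
  refine HalfEdge.forall_of_first_of_second
    (p := fun x => ∀ hx : x.edge = e, c x = if x.vertex = (HalfEdge.first e).vertex then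
      Fin.cast (congrArg D hx).symm (c (.first e)) else
      Fin.cast (congrArg D hx).symm (c (.second e)))
    (fun e' he => ?_) (fun e' he => ?_) x.1 x.2
  · obtain rfl : e' = e := he
    rw [if_pos rfl]
    rfl
  · obtain rfl : e' = e := he
    rw [if_neg (HalfEdge.vertex_second_ne_vertex_first e')]
    rfl

open scoped Classical in
theorem prod_eq_prod_mul_prod_mul_prod_compl {α M : Type*} [Fintype α] [CommMonoid M] {s t : Set α}
    (hst : Disjoint s t) (f : α → M) :
    ∏ a, f a = (∏ a : s, f a) * (∏ a : t, f a) * ∏ a : ((s ∪ t)ᶜ : Set α), f a := by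
  rw [Finset.prod_set_coe s, Finset.prod_set_coe t, Finset.prod_set_coe (s ∪ t)ᶜ,
    ← Finset.prod_union (Set.disjoint_toFinset.2 hst), ← Set.toFinset_union, Set.toFinset_compl,
    Finset.prod_mul_prod_compl]

open scoped Classical in
theorem EdgeLabel.sum_mul_mul_domRestrict [Fintype V] (hγ : Disjoint γ₁ γ₂)
    (f₁ : EdgeLabelOn D γ₁ → ℂ) (f₂ : EdgeLabelOn D γ₂ → ℂ) (f : EdgeLabelOn D (γ₁ ∪ γ₂)ᶜ → ℂ) :
    ∑ J : EdgeLabel D, f₁ (γ₁.domRestrict J) * f₂ (γ₂.domRestrict J) *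
      f ((γ₁ ∪ γ₂)ᶜ.domRestrict J) = (∑ I, f₁ I) * (∑ I, f₂ I) * ∑ I, f I := by
  refine ((EdgeLabel.splitEquiv D hγ).sum_comp fun y => f₁ y.1 * f₂ y.2.2 * f y.2.1).trans ?_
  simp only [Fintype.sum_prod_type, ← Finset.sum_mul, ← Finset.mul_sum]

open scoped Classical in
theorem exists_backgroundVector_eq_sum [Fintype V] (hγ : Disjoint γ₁ γ₂)
    {v₁ : Config D (halfEdgesOf γ₁) → ℂ} {v₂ : Config D (halfEdgesOf γ₂) → ℂ}
    (w : (e : G.edgeSet) → Config D (halfEdgesOf {e}) → ℂ)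
    (hv₁ : HasStandardSchmidt γ₁ v₁) (hv₂ : HasStandardSchmidt γ₂ v₂) :
    ∃ (B : LocalFamily D) (lam₁ : EdgeLabelOn D γ₁ → ℝ) (lam₂ : EdgeLabelOn D γ₂ → ℝ)
      (ν : (e : G.edgeSet) → Fin (D e) → ℝ),
      B.IsOrthonormal ∧ (∀ I, 0 ≤ lam₁ I) ∧ (∀ I, 0 ≤ lam₂ I) ∧ (∀ e l, 0 ≤ ν e l) ∧
      backgroundVector γ₁ γ₂ v₁ v₂ w =
        ∑ J, ((√(schmidtWeight lam₁ lam₂ ν J) : ℝ) : ℂ) • B.fullVec J := by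
  obtain ⟨lam₁, h₁, rfl⟩ := hv₁
  obtain ⟨lam₂, h₂, rfl⟩ := hv₂
  choose ν U W hν hU hW hw using fun e => exists_schmidt_edge e (w e)
  set B := schmidtFamily (γ₁ ∪ γ₂) U W
  refine ⟨B, lam₁, lam₂, ν, schmidtFamily_isOrthonormal hU hW, h₁, h₂, hν, funext fun c => ?_⟩
  have hw_edge (e : ((γ₁ ∪ γ₂)ᶜ : Set G.edgeSet)) : w e.1 (c.restrict _) =
      ∑ l, ((√(ν e.1 l) : ℝ) : ℂ) * B.edgeAmp c e.1 l := by
    simp only [hw, B, schmidtFamily_edgeAmp_of_notMem e.2]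
  have hprod₁ (I : EdgeLabelOn D γ₁) := prod_schmidtFamily_edgeAmp (U := U) (W := W) (c := c)
    (Set.subset_union_left (t := γ₂)) I
  have hprod₂ (I : EdgeLabelOn D γ₂) := prod_schmidtFamily_edgeAmp (U := U) (W := W) (c := c)
    (Set.subset_union_right (s := γ₁)) I
  simp only [backgroundVector, Finset.sum_apply, Pi.smul_apply, smul_eq_mul, hw_edge, ← hprod₁,
    ← hprod₂]
  rw [Finset.prod_univ_sum, Fintype.piFinset_univ, ← EdgeLabel.sum_mul_mul_domRestrict hγ]
  refine Finset.sum_congr rfl fun J _ => ?_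
  rw [B.fullVec_apply, prod_eq_prod_mul_prod_mul_prod_compl hγ, schmidtWeight,
    Real.sqrt_mul (mul_nonneg (h₁ _) (h₂ _)), Real.sqrt_mul (h₁ _),
    Real.sqrt_prod _ fun (e : ((γ₁ ∪ γ₂)ᶜ : Set G.edgeSet)) _ => hν e.1 (J e),
    Finset.prod_mul_distrib]
  push_cast
  simp only [Set.domRestrict_apply]
  ring

end BackgroundVector

section FilteredSuperposition

variable {m ι : Type*} [Fintype m] [Fintype ι] {v : ι → m → ℂ} {a b : ι → ℝ}

theorem IsOrthogonal.star_sum_sqrt_smul_dotProduct (hv : IsOrthogonal v 1) :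
    star (∑ i, ((√(a i) : ℝ) : ℂ) • v i) ⬝ᵥ ∑ i, ((√(b i) : ℝ) : ℂ) • v i =
      ((∑ i, √(a i) * √(b i) : ℝ) : ℂ) := by
  simp only [hv.star_sum_dotProduct_sum, RCLike.star_def, Complex.conj_ofReal, Pi.one_apply,
    Complex.ofReal_one, mul_one, Complex.ofReal_sum, Complex.ofReal_mul]

theorem IsOrthogonal.trace_pureState_sum_sqrt_smul (hv : IsOrthogonal v 1) (ha : ∀ i, 0 ≤ a i) :
    (pureState (∑ i, ((√(a i) : ℝ) : ℂ) • v i)).trace.re = ∑ i, a i := by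
  rw [trace_pureState, ← Complex.ofReal_inj, ← star_dotProduct_self_eq,
    hv.star_sum_sqrt_smul_dotProduct]
  simp only [Real.mul_self_sqrt (ha _)]

theorem IsOrthogonal.sum_le_fidelity_pureState [DecidableEq m] (hv : IsOrthogonal v 1)
    (hb : ∀ i, 0 ≤ b i) (hba : ∀ i, b i ≤ a i) :
    ∑ i, b i ≤ fidelity (pureState (∑ i, ((√(a i) : ℝ) : ℂ) • v i))
      (pureState (∑ i, ((√(b i) : ℝ) : ℂ) • v i)) := by
  rw [fidelity_pureState, hv.star_sum_sqrt_smul_dotProduct, Complex.norm_real]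
  refine (Finset.sum_le_sum fun i _ => ?_).trans (le_abs_self _)
  calc b i = √(b i) * √(b i) := (Real.mul_self_sqrt (hb i)).symm
    _ ≤ √(a i) * √(b i) := by gcongr; exact hba i

theorem IsOrthogonal.purifiedDistance_pureState_le [DecidableEq m] (hv : IsOrthogonal v 1)
    (hb : ∀ i, 0 ≤ b i) (hba : ∀ i, b i ≤ a i) (ha_sum : ∑ i, a i ≤ 1) :
    purifiedDistance (pureState (∑ i, ((√(a i) : ℝ) : ℂ) • v i))
        (pureState (∑ i, ((√(b i) : ℝ) : ℂ) • v i)) ≤ √(2 * ∑ i, (a i - b i)) := by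
  have h_le : ∑ i, b i ≤ ∑ i, a i := Finset.sum_le_sum fun i _ => hba i
  have h_sqrt : 1 - ∑ i, a i ≤ √((1 - ∑ i, a i) * (1 - ∑ i, b i)) :=
    Real.le_sqrt_of_sq_le (by nlinarith)
  have hF : 1 - ∑ i, (a i - b i) ≤ generalizedFidelity
      (pureState (∑ i, ((√(a i) : ℝ) : ℂ) • v i))
      (pureState (∑ i, ((√(b i) : ℝ) : ℂ) • v i)) := by
    rw [generalizedFidelity, hv.trace_pureState_sum_sqrt_smul fun i => (hb i).trans (hba i),
      hv.trace_pureState_sum_sqrt_smul hb, Finset.sum_sub_distrib]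
    linarith [hv.sum_le_fidelity_pureState hb hba]
  have hloss : ∑ i, (a i - b i) ≤ 1 :=
    (Finset.sum_le_sum fun i _ => sub_le_self _ (hb i)).trans ha_sum
  refine Real.sqrt_le_sqrt ?_
  nlinarith [pow_le_pow_left₀ (sub_nonneg.2 hloss) hF 2, sq_nonneg (∑ i, (a i - b i))]

end FilteredSuperposition

section JointFilter

theorem one_sub_prod_le_sum {ι : Type*} (s : Finset ι) {f : ι → ℝ} (h0 : ∀ i, 0 ≤ f i)
    (h1 : ∀ i, f i ≤ 1) : 1 - ∏ i ∈ s, f i ≤ ∑ i ∈ s, (1 - f i) := by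
  induction s using Finset.cons_induction with
  | empty => simp
  | cons a s ha ih =>
    rw [Finset.prod_cons, Finset.sum_cons]
    have hprod : ∏ i ∈ s, f i ≤ 1 := Finset.prod_le_one (fun i _ => h0 i) fun i _ => h1 i
    nlinarith [h1 a]

theorem sum_mul_one_sub_prod_le {ι L : Type*} [Fintype ι] [Fintype L] {μ : L → ℝ}
    {f : ι → L → ℝ} (hμ : ∀ J, 0 ≤ μ J) (h0 : ∀ i J, 0 ≤ f i J) (h1 : ∀ i J, f i J ≤ 1) {ε : ℝ}
    (hε : ∀ i, ∑ J, μ J * (1 - f i J) ≤ ε) :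
    ∑ J, μ J * (1 - ∏ i, f i J) ≤ Fintype.card ι * ε := by
  calc ∑ J, μ J * (1 - ∏ i, f i J) ≤ ∑ J, μ J * ∑ i, (1 - f i J) :=
        Finset.sum_le_sum fun J _ => mul_le_mul_of_nonneg_left
          (one_sub_prod_le_sum _ (fun i => h0 i J) fun i => h1 i J) (hμ J)
    _ = ∑ i, ∑ J, μ J * (1 - f i J) := by
        simp only [Finset.mul_sum]
        exact Finset.sum_comm
    _ ≤ Fintype.card ι * ε := by
        rw [← nsmul_eq_mul, ← Finset.card_univ]
        exact Finset.sum_le_card_nsmul _ _ _ fun i _ => hε i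

theorem ncard_cuts_le {V : Type*} [Finite V] (bdry A : Set V) :
    (cuts bdry A).ncard ≤ 2 ^ (bdryᶜ).ncard := by
  rw [← Set.ncard_powerset]
  refine Set.ncard_le_ncard_of_injOn (· ∩ bdryᶜ) (fun Δ _ => Set.inter_subset_right)
    fun Δ hΔ Δ' hΔ' h => ?_
  rw [← Set.inter_union_compl Δ bdry, ← Set.inter_union_compl Δ' bdry]
  exact congrArg₂ _ (hΔ.trans hΔ'.symm) h

open scoped Classical in
theorem LocalFamily.IsOrthonormal.exists_isSubState_of_isSmoothingFilter {V : Type*} [Fintype V]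
    {G : SimpleGraph V} {D : G.edgeSet → ℕ} {B : LocalFamily D} (hB : B.IsOrthonormal)
    {μ : EdgeLabel D → ℝ} (hμ : ∀ J, 0 ≤ μ J) (h_sum : ∑ J, μ J ≤ 1) {ι : Type*} [Fintype ι]
    {X W : ι → Set (HalfEdge G)} {U : Set (HalfEdge G)} {ε : ℝ} {F : ι → EdgeLabel D → ℝ}
    (hF : ∀ i, B.IsSmoothingFilter (X i) U (W i) μ ε (F i)) :
    ∃ φ' : Matrix (FullConfig D) (FullConfig D) ℂ, IsSubState φ' ∧
      purifiedDistance (pureState (∑ J, ((√(μ J) : ℝ) : ℂ) • B.fullVec J)) φ' ≤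
        √(2 * (Fintype.card ι * ε)) ∧
      ∀ i, smoothCondMinEntropy ε
          (reducedState (X i) (W i) (pureState (∑ J, ((√(μ J) : ℝ) : ℂ) • B.fullVec J))) ≤
        condMinEntropy (reducedState (X i) U φ') := by
  set g : EdgeLabel D → ℝ := fun J => ∏ i, F i J
  have hg_nonneg (J) : 0 ≤ g J := Finset.prod_nonneg fun i _ => (hF i).nonneg J
  have hg_le (i J) : g J ≤ F i J := by
    refine (Finset.mul_prod_erase _ (F · J) (Finset.mem_univ i)).ge.trans ?_
    exact mul_le_of_le_one_right ((hF i).nonneg J)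
      (Finset.prod_le_one (fun j _ => (hF j).nonneg J) fun j _ => (hF j).le_one J)
  have hμg_nonneg (J) : 0 ≤ μ J * g J := mul_nonneg (hμ J) (hg_nonneg J)
  have hμg_le (J) : μ J * g J ≤ μ J := mul_le_of_le_one_right (hμ J)
    (Finset.prod_le_one (fun i _ => (hF i).nonneg J) fun i _ => (hF i).le_one J)
  refine ⟨pureState (∑ J, ((√(μ J * g J) : ℝ) : ℂ) • B.fullVec J), ⟨pureState_posSemidef _, ?_⟩,
    ?_, fun i => (hF i).smoothCondMinEntropy_le g
      (fun J J' h => Finset.prod_congr rfl fun j _ => (hF j).dependsOn h) hg_nonneg (hg_le i)⟩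
  · rw [hB.isOrthogonal_fullVec.trace_pureState_sum_sqrt_smul hμg_nonneg]
    exact (Finset.sum_le_sum fun J _ => hμg_le J).trans h_sum
  · refine (hB.isOrthogonal_fullVec.purifiedDistance_pureState_le hμg_nonneg hμg_le h_sum).trans ?_
    gcongr
    simp only [← mul_one_sub]
    exact sum_mul_one_sub_prod_le hμ (fun i => (hF i).nonneg) (fun i => (hF i).le_one)
      fun i => (hF i).sum_le

end JointFilter

open scoped Classical in
theorem mainTheorem9 {V : Type*} [Fintype V] (G : SimpleGraph V) (D : G.edgeSet → ℕ)
    (bdry A : Set V) (hA : A ⊆ bdry)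
    (hdisj : Disjoint (incidentEdges G A) (incidentEdges G (bdry \ A)))
    (v₁ : Config D (halfEdgesOf (incidentEdges G A)) → ℂ)
    (v₂ : Config D (halfEdgesOf (incidentEdges G (bdry \ A))) → ℂ)
    (w : (e : G.edgeSet) → Config D (halfEdgesOf {e}) → ℂ)
    (hv₁ : HasStandardSchmidt (incidentEdges G A) v₁)
    (hv₂ : HasStandardSchmidt (incidentEdges G (bdry \ A)) v₂)
    (φ : Matrix (FullConfig D) (FullConfig D) ℂ)
    (hφ : φ = pureState
      (backgroundVector (incidentEdges G A) (incidentEdges G (bdry \ A)) v₁ v₂ w))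
    (hφ_sub : IsSubState φ) (ε : ℝ) (hε : 0 ≤ ε) :
    ∃ φε : Matrix (FullConfig D) (FullConfig D) ℂ, IsSubState φε ∧
      purifiedDistance φ φε ≤ 2 * √(2 ^ (bdryᶜ).ncard * ε) ∧
      ∀ Δ ∈ cuts bdry A,
        smoothCondMinEntropy ε
            (reducedState (halfEdgesAt G (Δ \ A))
              (halfEdgesAt G A ∪ outerHalfEdges G A Δ) φ) ≤
          condMinEntropy
            (reducedState (halfEdgesAt G (Δ \ A)) (halfEdgesAt G A) φε) := by
  classical
  obtain ⟨B, lam₁, lam₂, ν, hB, h₁, h₂, hν, hvec⟩ :=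
    exists_backgroundVector_eq_sum hdisj w hv₁ hv₂
  have hμ := schmidtWeight_nonneg h₁ h₂ hν
  set μ := schmidtWeight lam₁ lam₂ ν
  rw [hvec] at hφ
  have h_sum : ∑ J, μ J ≤ 1 := by
    rw [← hB.isOrthogonal_fullVec.trace_pureState_sum_sqrt_smul hμ, ← hφ]
    exact hφ_sub.2
  choose F hF using fun Δ : cuts bdry A =>
    hB.exists_isSmoothingFilter_of_mem_cuts hdisj Δ.2 h₁ h₂ hν h_sum hε
  obtain ⟨φε, hφε, hdist, hent⟩ := hB.exists_isSubState_of_isSmoothingFilter hμ h_sum hF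
  have hcard : (Fintype.card (cuts bdry A) : ℝ) ≤ 2 ^ (bdryᶜ).ncard := by
    rw [← Nat.card_eq_fintype_card]
    exact_mod_cast ncard_cuts_le bdry A
  refine ⟨φε, hφε, ?_, fun Δ hΔ => hφ ▸ hent ⟨Δ, hΔ⟩⟩
  calc purifiedDistance φ φε ≤ √(2 * (Fintype.card (cuts bdry A) * ε)) := hφ ▸ hdist
    _ ≤ √(2 ^ 2 * (2 ^ (bdryᶜ).ncard * ε)) := by gcongr; norm_num
    _ = 2 * √(2 ^ (bdryᶜ).ncard * ε) := by
      rw [Real.sqrt_mul (by positivity), Real.sqrt_sq zero_le_two]
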